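/- Let $(X,\tau)$ be a Polish space and $1\le\xi<\omega_1$. A function $f:X\to\mathbb R$ is of Baire class $0$ if it is continuous, and of Baire class $\zeta\geq 1$ if it is the pointwise limit of functions $f_n$ of Baire classes $\zeta_n<\zeta$; $\mathcal B_\zeta(\tau)$ denotes the set of Baire class $\zeta$ functions of $(X,\tau)$. For a map $D$ sending closed sets to closed subsets of themselves, monotonically, put $D^0(F)=F$, $D^{\eta+1}(F)=D(D^\eta(F))$, $D^\eta(F)=\bigcap_{\theta<\eta}D^\theta(F)$ for limit $\eta$, and let $\mathrm{rk}(D)$ be the least $\eta$ with $D^\eta(X)=\emptyset$ if such an $\eta$ exists, and $\omega_1$ otherwise. For a Polish topology $\tau'$ on $X$ and $f\in\mathcal B_1(\tau')$ let $$\beta_{\tau'}(f)=\sup_{\varepsilon>0}\mathrm{rk}\Big(F\mapsto\{x\in F:\ \inf_{U\ni x\ \tau'\text{-open}}\ \sup_{x_1,x_2\in U\cap F}|f(x_1)-f(x_2)|\ge\varepsilon\}\Big),$$ and let $\gamma_{\tau'}(f)$ be the minimum, over all sequences $(f_n)$ of $\tau'$-continuous real functions converging pointwise to $f$, of $$\sup_{\varepsilon>0}\mathrm{rk}\Big(F\mapsto\{x\in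 F:\ \inf_{U\ni x\ \tau'\text{-open}}\ \inf_{N}\ \sup_{m,n\ge N,\ y\in U\cap F}|f_m(y)-f_n(y)|\ge\varepsilon\}\Big).$$ For $f\in\mathcal B_\xi(\tau)$ let $T_{f,\xi}$ be the set of Polish topologies $\tau'\supseteq\tau$ on $X$ with $\tau'\subseteq\boldsymbol\Sigma^0_\xi(\tau)$ and $f\in\mathcal B_1(\tau')$, and define $$\beta^*_\xi(f)=\min_{\tau'\in T_{f,\xi}}\beta_{\tau'}(f),\qquad \gamma^*_\xi(f)=\min_{\tau'\in T_{f,\xi}}\gamma_{\tau'}(f).$$ For ordinals write $\theta\lesssim\theta'$ if $\theta'\le\omega^\eta$ implies $\theta\le\omega^\eta$ for every $1\le\eta<\omega_1$ (ordinal exponentiation). Then $\mathcal B_\xi(\tau)$ is closed under sums and under multiplication by real constants, the set $T_{f,\xi}$ is nonempty for every $f\in\mathcal B_\xi(\tau)$, and $\beta^*_\xi$ and $\gamma^*_\xi$ are essentially linear maps $\mathcal B_\xi(\tau)\to\omega_1$: for all $f,g\in\mathcal B_\xi(\tau)$ and $c\in\mathbb R\setminus\{0\}$, the ordinals $\beta^*_\xi(f)$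 and $\gamma^*_\xi(f)$ are countable, $$\beta^*_\xi(cf)=\beta^*_\xi(f),\qquad \gamma^*_\xi(cf)=\gamma^*_\xi(f),$$ $$\beta^*_\xi(f+g)\lesssim\max\{\beta^*_\xi(f),\beta^*_\xi(g)\},\qquad \gamma^*_\xi(f+g)\lesssim\max\{\gamma^*_\xi(f),\gamma^*_\xi(g)\}.$$ -/

import Mathlib

open scoped ENNReal Topology Ordinal

section

variable {X : Type*}

/-- `IsSigma0 τ ξ s`: the set `s` belongs to the additive Borel class `Σ⁰_ξ` of the topology `τ`
(for `ξ ≥ 1`): `Σ⁰_1` consists of the open sets, and for `ξ > 1` the sets in `Σ⁰_ξ` are the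
countable unions of complements of sets in `Σ⁰_{ζ n}` with `1 ≤ ζ n < ξ`. The class with index `0`
is empty, so the constraints `1 ≤ ζ n` and `1 < ξ` in the second clause are automatic. -/
inductive IsSigma0 (τ : TopologicalSpace X) : Ordinal.{0} → Set X → Prop
  | of_isOpen (s : Set X) (hs : IsOpen[τ] s) : IsSigma0 τ 1 s
  | iUnion (ξ : Ordinal.{0}) (ζ : ℕ → Ordinal.{0}) (A : ℕ → Set X) (hζ : ∀ n, ζ n < ξ)
      (hA : ∀ n, IsSigma0 τ (ζ n) (A n)ᶜ) : IsSigma0 τ ξ (⋃ n, A n)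

/-- `IsBaireClass τ ξ f`: the function `f` is of Baire class `ξ` for the topology `τ`. Class `0`
consists of the continuous functions; `f` is of class `ξ` if it is the pointwise limit of functions
`f n` of classes `ζ n < ξ`. -/
inductive IsBaireClass (τ : TopologicalSpace X) : Ordinal.{0} → (X → ℝ) → Prop
  | of_continuous (f : X → ℝ) (hf : Continuous[τ, inferInstance] f) : IsBaireClass τ 0 f
  | of_tendsto (ξ : Ordinal.{0}) (ζ : ℕ → Ordinal.{0}) (fs : ℕ → X → ℝ) (f : X → ℝ)
      (hζ : ∀ n, ζ n < ξ) (hfs : ∀ n, IsBaireClass τ (ζ n) (fs n))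
      (hlim : ∀ x, Filter.Tendsto (fun n => fs n x) Filter.atTop (𝓝 (f x))) : IsBaireClass τ ξ f

/-- The iterated derivatives `D^η(F)`. -/
noncomputable def iterDeriv (D : Set X → Set X) (F : Set X) (η : Ordinal.{0}) : Set X :=
  Ordinal.limitRecOn η F (fun _ A => D A) (fun η _ A => ⋂ (θ : Ordinal.{0}) (h : θ < η), A θ h)

open Classical in
/-- The rank of a derivative `D`: the least ordinal `η` with `D^η(X) = ∅` if there is one, and `ω₁`
otherwise. -/
noncomputable def derivRank (D : Set X → Set X) : Ordinal.{0} :=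
  if ∃ η : Ordinal.{0}, iterDeriv D Set.univ η = ∅ then
    sInf {η : Ordinal.{0} | iterDeriv D Set.univ η = ∅}
  else ω₁

/-- The oscillation `ω(f, x, F)`, as an extended nonnegative real. -/
noncomputable def osc (τ : TopologicalSpace X) (f : X → ℝ) (x : X) (F : Set X) : ℝ≥0∞ :=
  ⨅ (U : Set X) (_ : IsOpen[τ] U) (_ : x ∈ U),
    ⨆ (x₁ : X) (_ : x₁ ∈ U ∩ F) (x₂ : X) (_ : x₂ ∈ U ∩ F), ENNReal.ofReal |f x₁ - f x₂|

/-- The derivative `D_{f, ε}`. -/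
def oscDeriv (τ : TopologicalSpace X) (f : X → ℝ) (ε : ℝ) (F : Set X) : Set X :=
  {x | x ∈ F ∧ ENNReal.ofReal ε ≤ osc τ f x F}

/-- The oscillation rank `β(f) = sup_{ε > 0} rk(D_{f, ε})` with respect to `τ`. -/
noncomputable def betaRank (τ : TopologicalSpace X) (f : X → ℝ) : Ordinal.{0} :=
  ⨆ ε : {ε : ℝ // 0 < ε}, derivRank (oscDeriv τ f ε)

/-- The oscillation `ω((f_n), x, F)` of a sequence of functions, as an extended nonnegative
real. -/
noncomputable def seqOsc (τ : TopologicalSpace X) (fs : ℕ → X → ℝ) (x : X) (F : Set X) : ℝ≥0∞ :=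
  ⨅ (U : Set X) (_ : IsOpen[τ] U) (_ : x ∈ U), ⨅ N : ℕ,
    ⨆ (m : ℕ) (_ : N ≤ m) (n : ℕ) (_ : N ≤ n) (y : X) (_ : y ∈ U ∩ F),
      ENNReal.ofReal |fs m y - fs n y|

/-- The derivative `D_{(f_n), ε}`. -/
def seqOscDeriv (τ : TopologicalSpace X) (fs : ℕ → X → ℝ) (ε : ℝ) (F : Set X) : Set X :=
  {x | x ∈ F ∧ ENNReal.ofReal ε ≤ seqOsc τ fs x F}

/-- `sup_{ε > 0} γ((f_n), ε)`. -/
noncomputable def seqRank (τ : TopologicalSpace X) (fs : ℕ → X → ℝ) : Ordinal.{0} :=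
  ⨆ ε : {ε : ℝ // 0 < ε}, derivRank (seqOscDeriv τ fs ε)

/-- The convergence rank `γ(f)` with respect to `τ`: the minimum of `sup_{ε > 0} γ((f_n), ε)` over
all sequences of `τ`-continuous functions that converge to `f` pointwise (such sequences exist
exactly when `f` is of Baire class `1`). -/
noncomputable def gammaRank (τ : TopologicalSpace X) (f : X → ℝ) : Ordinal.{0} :=
  sInf {θ : Ordinal.{0} | ∃ fs : ℕ → X → ℝ, (∀ n, Continuous[τ, inferInstance] (fs n)) ∧
    (∀ x, Filter.Tendsto (fun n => fs n x) Filter.atTop (𝓝 (f x))) ∧ seqRank τ fs = θ}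

/-- `T_{f, ξ}`: the Polish topologies `τ'` on `X` that refine `τ` (in Mathlib `τ' ≤ τ` says that
every `τ`-open set is `τ'`-open), consist of `Σ⁰_ξ(τ)` sets, and make `f` a function of Baire
class `1`. -/
def refinements (τ : TopologicalSpace X) (ξ : Ordinal.{0}) (f : X → ℝ) :
    Set (TopologicalSpace X) :=
  {τ' | τ' ≤ τ ∧ @PolishSpace X τ' ∧ (∀ s, IsOpen[τ'] s → IsSigma0 τ ξ s) ∧ IsBaireClass τ' 1 f}

/-- `ρ*_ξ(f)`: the minimum of `ρ_{τ'}(f)` over `τ' ∈ T_{f, ξ}`. -/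
noncomputable def starRank (ρ : TopologicalSpace X → (X → ℝ) → Ordinal.{0})
    (τ : TopologicalSpace X) (ξ : Ordinal.{0}) (f : X → ℝ) : Ordinal.{0} :=
  sInf {θ : Ordinal.{0} | ∃ τ' ∈ refinements τ ξ f, ρ τ' f = θ}

/-- `β*_ξ`. -/
noncomputable def betaStar (τ : TopologicalSpace X) (ξ : Ordinal.{0}) (f : X → ℝ) : Ordinal.{0} :=
  starRank betaRank τ ξ f

/-- `γ*_ξ`. -/
noncomputable def gammaStar (τ : TopologicalSpace X) (ξ : Ordinal.{0}) (f : X → ℝ) :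
    Ordinal.{0} :=
  starRank gammaRank τ ξ f

end

/-- `θ ≲ θ'`. -/
def EssLE (θ θ' : Ordinal.{0}) : Prop :=
  ∀ η : Ordinal.{0}, 1 ≤ η → η < ω₁ → θ' ≤ ω ^ η → θ ≤ ω ^ η

/-!
The proof has two independent parts: a calculus of ranks in a fixed Polish topology, and a supply of
Polish refinements.

*Ranks.* Both derivatives have the form `F ↦ {x ∈ F | φ (U ∩ F) ≥ ε for all open U ∋ x}` with a
monotone set function `φ`, and are therefore local (`IsLocalDeriv`): they commute with restriction
to open sets, and so do their iterates. If local derivatives satisfy `D F ⊆ D₁ F ∪ D₂ F`, then a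
point surviving `n` steps of `D` survives `i` steps of `D₁` and `j` steps of `D₂` for some
`i + j = n` (`IsLocalDeriv.exists_add_eq_of_mem_iterDeriv`). Applied to the `ω ^ η`-th iterates
this is the successor step of an induction showing
`D^{ω^η} F ⊆ D₁^{ω^η} F ∪ D₂^{ω^η} F` (`IsLocalDeriv.iterDeriv_omega0_opow_subset`), from which
essential additivity of `β` and `γ` in one topology follows, since the `ε`-derivative of a sum lies
in the union of the `ε / 2`-derivatives of the summands. The Baire category theorem makes the
derivatives of a convergent sequence of continuous functions strictly decreasing on nonempty closed
sets, so that they reach `∅` at a countable stage (`IsLocalDeriv.exists_iterDeriv_eq_empty`); the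
derivatives of the limit function are contained in them.

*Refinements.* The graph of a function `f` of Baire class `1` on a Polish space is a `Gδ` set, so
adjoining the preimages of open sets under `f`, which are `Fσ` sets, yields a Polish topology in
which `f` is continuous. Together with the fact that countably many Polish refinements have a Polish
supremum, induction on `ζ` makes every function of class `ζ` continuous in a Polish refinement by
`Σ⁰_{ζ + 1}` sets (`IsBaireClass.exists_continuous_refinement`). Doing this for a sequence that
witnesses `f ∈ 𝓑_ξ` gives a member of `T_{f, ξ}`. Two topologies attaining the minima for `f` and
`g` have a common refinement in `T_{f + g, ξ}` (`exists_common_refinement`); refining the topology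
does not increase the ranks, so the additivity in a single topology applies there.
-/

/-! ### Local derivatives and their iterates -/

section LocalDerivatives

variable {X : Type*}

@[simp]
theorem iterDeriv_zero (D : Set X → Set X) (F : Set X) : iterDeriv D F 0 = F :=
  Ordinal.limitRecOn_zero _ _ _

@[simp]
theorem iterDeriv_add_one (D : Set X → Set X) (F : Set X) (η : Ordinal.{0}) :
    iterDeriv D F (η + 1) = D (iterDeriv D F η) :=
  Ordinal.limitRecOn_add_one _ _ _ _

theorem mem_iterDeriv_limit {D : Set X → Set X} {F : Set X} {η : Ordinal.{0}}
    (hη : Order.IsSuccLimit η) {x : X} :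
    x ∈ iterDeriv D F η ↔ ∀ θ < η, x ∈ iterDeriv D F θ := by
  have h : iterDeriv D F η = ⋂ (θ : Ordinal.{0}) (_ : θ < η), iterDeriv D F θ :=
    Ordinal.limitRecOn_limit _ _ _ _ hη
  simp [h]

theorem iterDeriv_antitone {D : Set X → Set X} (hD : ∀ F, D F ⊆ F) (F : Set X) :
    Antitone (iterDeriv D F) := by
  intro θ η h
  induction η using Ordinal.limitRecOn with
  | zero => rw [nonpos_iff_eq_zero.1 h]
  | add_one η ih =>
    rcases h.eq_or_lt with rfl | h
    · exact subset_rfl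
    · rw [iterDeriv_add_one]
      exact (hD _).trans (ih (Order.lt_add_one_iff.1 h))
  | limit η hη ih =>
    rcases h.eq_or_lt with rfl | h
    · exact subset_rfl
    · exact fun x hx => (mem_iterDeriv_limit hη).1 hx θ h

theorem iterDeriv_subset_iterDeriv {D D' : Set X → Set X} (hD' : Monotone D')
    (h : ∀ F, D F ⊆ D' F) (F : Set X) (η : Ordinal.{0}) :
    iterDeriv D F η ⊆ iterDeriv D' F η := by
  induction η using Ordinal.limitRecOn with
  | zero => simp
  | add_one η ih => simpa using (h _).trans (hD' ih)
  | limit η hη ih =>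
    intro x hx
    rw [mem_iterDeriv_limit hη] at hx ⊢
    exact fun θ hθ => ih θ hθ (hx θ hθ)

theorem iterDeriv_add {D : Set X → Set X} (hD : ∀ F, D F ⊆ F) (F : Set X) (η θ : Ordinal.{0}) :
    iterDeriv D F (η + θ) = iterDeriv D (iterDeriv D F η) θ := by
  induction θ using Ordinal.limitRecOn with
  | zero => simp
  | add_one θ ih => rw [← add_assoc, iterDeriv_add_one, ih, iterDeriv_add_one]
  | limit θ hθ ih =>
    ext x
    rw [mem_iterDeriv_limit (Ordinal.isSuccLimit_add η hθ), mem_iterDeriv_limit hθ]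
    constructor
    · intro h ζ hζ
      rw [← ih ζ hζ]
      exact h _ (by gcongr)
    · intro h ζ hζ
      rcases lt_or_ge ζ η with hlt | hge
      · have h0 := h 0 hθ.bot_lt
        rw [iterDeriv_zero] at h0
        exact iterDeriv_antitone hD F hlt.le h0
      · obtain ⟨ζ', rfl⟩ := le_iff_exists_add.1 hge
        have hlt : ζ' < θ := by simpa using hζ
        rw [ih ζ' hlt]
        exact h ζ' hlt

/-- A local derivative: an operation on all subsets of a space that shrinks each set to a relatively
closed subset, is monotone, and commutes with restriction to open sets. The last condition is what
a merely monotone derivative lacks: it lets one replace a set by its trace on a small neighbourhood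
of a point. -/
structure IsLocalDeriv [TopologicalSpace X] (D : Set X → Set X) : Prop where
  subset (F : Set X) : D F ⊆ F
  mono : Monotone D
  inter_subset (F U : Set X) (hU : IsOpen U) : D F ∩ U ⊆ D (F ∩ U)
  closure_inter (F : Set X) : closure (D F) ∩ F ⊆ D F

namespace IsLocalDeriv

variable [TopologicalSpace X] {D D₁ D₂ : Set X → Set X}

theorem iterDeriv (hD : IsLocalDeriv D) (η : Ordinal.{0}) :
    IsLocalDeriv fun F => iterDeriv D F η := by
  induction η using Ordinal.limitRecOn with
  | zero =>
    simp only [iterDeriv_zero]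
    exact ⟨fun _ => subset_rfl, fun _ _ h => h, fun _ _ _ => subset_rfl,
      fun _ => Set.inter_subset_right⟩
  | add_one η ih =>
    simp only [iterDeriv_add_one]
    refine ⟨fun F => (hD.subset _).trans (ih.subset F), fun _ _ h => hD.mono (ih.mono h),
      fun F U hU => (hD.inter_subset _ _ hU).trans (hD.mono (ih.inter_subset F U hU)), ?_⟩
    rintro F x ⟨hx, hxF⟩
    exact hD.closure_inter _
      ⟨hx, ih.closure_inter F ⟨closure_mono (hD.subset _) hx, hxF⟩⟩
  | limit η hη ih =>
    refine ⟨fun F => ?_, fun F G h x hx => ?_, fun F U hU x hx => ?_, fun F x hx => ?_⟩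
    · simpa using iterDeriv_antitone hD.subset F (zero_le (a := η))
    · rw [mem_iterDeriv_limit hη] at hx ⊢
      exact fun θ hθ => (ih θ hθ).mono h (hx θ hθ)
    · rw [Set.mem_inter_iff, mem_iterDeriv_limit hη] at hx
      rw [mem_iterDeriv_limit hη]
      exact fun θ hθ => (ih θ hθ).inter_subset F U hU ⟨hx.1 θ hθ, hx.2⟩
    · rw [mem_iterDeriv_limit hη]
      exact fun θ hθ => (ih θ hθ).closure_inter F
        ⟨closure_mono (iterDeriv_antitone hD.subset F hθ.le) hx.1, hx.2⟩

theorem isClosed_iterDeriv (hD : IsLocalDeriv D) (η : Ordinal.{0}) :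
    IsClosed (_root_.iterDeriv D Set.univ η) := by
  refine closure_subset_iff_isClosed.1 fun x hx => ?_
  exact (hD.iterDeriv η).closure_inter _ ⟨hx, Set.mem_univ x⟩

/-- Additivity of finite ranks: a point that survives `n` steps of a derivative dominated by
`D₁ ∪ D₂` survives `i` steps of `D₁` and `j` steps of `D₂` with `i + j = n`. Near a point `x` at
which the largest such `i` and `j` are `a` and `b`, no point survives more than `a` steps of `D₁`
or `b` steps of `D₂`; if `a + b ≤ n`, then all survivors of `n` steps near `x` survive exactly
`a` and `b` steps, and one more step of `D` cannot keep `x`. -/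
theorem exists_add_eq_of_mem_iterDeriv (hD : IsLocalDeriv D) (h₁ : IsLocalDeriv D₁)
    (h₂ : IsLocalDeriv D₂) (h : ∀ F, D F ⊆ D₁ F ∪ D₂ F) (F : Set X) (n : ℕ) {x : X}
    (hx : x ∈ _root_.iterDeriv D F n) :
    ∃ i j : ℕ, i + j = n ∧ x ∈ _root_.iterDeriv D₁ F i ∧ x ∈ _root_.iterDeriv D₂ F j := by
  induction n generalizing x with
  | zero => exact ⟨0, 0, rfl, by simpa using hx, by simpa using hx⟩
  | succ n ih =>
    have anti₁ {i j : ℕ} (hij : i ≤ j) :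
        _root_.iterDeriv D₁ F j ⊆ _root_.iterDeriv D₁ F i :=
      iterDeriv_antitone h₁.subset F (by exact_mod_cast hij)
    have anti₂ {i j : ℕ} (hij : i ≤ j) :
        _root_.iterDeriv D₂ F j ⊆ _root_.iterDeriv D₂ F i :=
      iterDeriv_antitone h₂.subset F (by exact_mod_cast hij)
    have hxF : x ∈ F := (hD.iterDeriv _).subset F hx
    by_contra! hcon
    -- the exact number of steps of each derivative that `x` survives
    have key : ∀ D' : Set X → Set X, x ∉ _root_.iterDeriv D' F (n + 1 : ℕ) →
        ∃ a : ℕ, x ∈ _root_.iterDeriv D' F a ∧ x ∉ _root_.iterDeriv D' F (a + 1 : ℕ) := by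
      intro D' hn
      by_contra! hall
      refine hn ?_
      generalize n + 1 = k
      induction k with
      | zero => simpa using hxF
      | succ k ihk => exact hall k ihk
    obtain ⟨a, ha, ha'⟩ := key D₁ fun h' => hcon (n + 1) 0 rfl h' (by simpa using hxF)
    obtain ⟨b, hb, hb'⟩ := key D₂ fun h' => hcon 0 (n + 1) (by simp) (by simpa using hxF) h'
    have hab : a + b ≤ n := by
      by_contra! hlt
      exact hcon (min a (n + 1)) (n + 1 - min a (n + 1)) (by omega)
        (anti₁ (by omega) ha) (anti₂ (by omega) hb)
    set U := (closure (_root_.iterDeriv D₁ F (a + 1 : ℕ)))ᶜ ∩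
      (closure (_root_.iterDeriv D₂ F (b + 1 : ℕ)))ᶜ with hUdef
    have hU : IsOpen U := isClosed_closure.isOpen_compl.inter isClosed_closure.isOpen_compl
    have hxU : x ∈ U := ⟨fun hc => ha' ((h₁.iterDeriv _).closure_inter F ⟨hc, hxF⟩),
      fun hc => hb' ((h₂.iterDeriv _).closure_inter F ⟨hc, hxF⟩)⟩
    have hsub : _root_.iterDeriv D F n ∩ U ⊆
        _root_.iterDeriv D₁ F a ∩ _root_.iterDeriv D₂ F b := by
      rintro y ⟨hy, hyU⟩
      obtain ⟨i, j, hij, hi, hj⟩ := ih hy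
      have hia : i ≤ a := by
        by_contra! hlt
        exact hyU.1 (subset_closure (anti₁ hlt hi))
      have hjb : j ≤ b := by
        by_contra! hlt
        exact hyU.2 (subset_closure (anti₂ hlt hj))
      obtain rfl : i = a := by omega
      obtain rfl : j = b := by omega
      exact ⟨hi, hj⟩
    rw [Nat.cast_succ, iterDeriv_add_one] at hx
    rw [Nat.cast_succ, iterDeriv_add_one] at ha' hb'
    rcases h _ (hD.mono hsub (hD.inter_subset _ _ hU ⟨hx, hxU⟩)) with h' | h'
    · exact ha' (h₁.mono Set.inter_subset_left h')
    · exact hb' (h₂.mono Set.inter_subset_right h')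

theorem iterDeriv_omega0_subset (hD : IsLocalDeriv D) (h₁ : IsLocalDeriv D₁)
    (h₂ : IsLocalDeriv D₂) (h : ∀ F, D F ⊆ D₁ F ∪ D₂ F) (F : Set X) :
    _root_.iterDeriv D F ω ⊆ _root_.iterDeriv D₁ F ω ∪ _root_.iterDeriv D₂ F ω := by
  intro x hx
  by_contra hcon
  have hlim := Ordinal.isSuccLimit_omega0
  simp only [Set.mem_union, mem_iterDeriv_limit hlim, Ordinal.lt_omega0, not_or, not_forall] at hcon
  obtain ⟨⟨_, ⟨p, rfl⟩, hp⟩, _, ⟨q, rfl⟩, hq⟩ := hcon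
  obtain ⟨i, j, hij, hi, hj⟩ := hD.exists_add_eq_of_mem_iterDeriv h₁ h₂ h F (p + q)
    ((mem_iterDeriv_limit hlim).1 hx _ (Ordinal.natCast_lt_omega0 _))
  rcases le_or_gt p i with hpi | hpi
  · exact hp (iterDeriv_antitone h₁.subset F (by exact_mod_cast hpi) hi)
  · have hqj : q ≤ j := by omega
    exact hq (iterDeriv_antitone h₂.subset F (by exact_mod_cast hqj) hj)

end IsLocalDeriv

theorem iterDeriv_mul_natCast {D : Set X → Set X} (hD : ∀ F, D F ⊆ F) (F : Set X)
    (η : Ordinal.{0}) (n : ℕ) :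
    iterDeriv D F (η * n) = iterDeriv (fun G => iterDeriv D G η) F n := by
  induction n with
  | zero => simp
  | succ n ih => rw [Nat.cast_succ, mul_add_one, iterDeriv_add hD, ih, iterDeriv_add_one]

theorem iterDeriv_mul_omega0 {D : Set X → Set X} (hD : ∀ F, D F ⊆ F) (F : Set X)
    {η : Ordinal.{0}} (hη : η ≠ 0) :
    iterDeriv D F (η * ω) = iterDeriv (fun G => iterDeriv D G η) F ω := by
  ext x
  rw [mem_iterDeriv_limit Ordinal.isSuccLimit_omega0, mem_iterDeriv_limit
    (Ordinal.isSuccLimit_mul_right (pos_iff_ne_zero.2 hη) Ordinal.isSuccLimit_omega0)]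
  constructor
  · intro h θ hθ
    obtain ⟨n, rfl⟩ := Ordinal.lt_omega0.1 hθ
    rw [← iterDeriv_mul_natCast hD]
    exact h _ (by gcongr)
  · intro h θ hθ
    obtain ⟨_, hc, hθ⟩ := (Ordinal.lt_mul_iff_of_isSuccLimit Ordinal.isSuccLimit_omega0).1 hθ
    obtain ⟨n, rfl⟩ := Ordinal.lt_omega0.1 hc
    refine iterDeriv_antitone hD F hθ.le ?_
    rw [iterDeriv_mul_natCast hD]
    exact h _ hc

/-- Iterating a derivative dominated by the union of two others `ω ^ η` times is dominated by the
union of the `ω ^ η`-th iterates. -/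
theorem IsLocalDeriv.iterDeriv_omega0_opow_subset [TopologicalSpace X] {D D₁ D₂ : Set X → Set X}
    (hD : IsLocalDeriv D) (h₁ : IsLocalDeriv D₁) (h₂ : IsLocalDeriv D₂)
    (h : ∀ F, D F ⊆ D₁ F ∪ D₂ F) (η : Ordinal.{0}) (F : Set X) :
    _root_.iterDeriv D F (ω ^ η) ⊆
      _root_.iterDeriv D₁ F (ω ^ η) ∪ _root_.iterDeriv D₂ F (ω ^ η) := by
  induction η using Ordinal.limitRecOn generalizing F with
  | zero =>
    have e (D : Set X → Set X) : _root_.iterDeriv D F (ω ^ (0 : Ordinal)) = D F := by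
      rw [Ordinal.opow_zero, ← zero_add 1, iterDeriv_add_one, iterDeriv_zero]
    simpa only [e] using h F
  | add_one η ih =>
    have h0 : (ω : Ordinal.{0}) ^ η ≠ 0 := Ordinal.opow_ne_zero _ Ordinal.omega0_ne_zero
    rw [Ordinal.opow_add_one, iterDeriv_mul_omega0 hD.subset F h0,
      iterDeriv_mul_omega0 h₁.subset F h0, iterDeriv_mul_omega0 h₂.subset F h0]
    exact (hD.iterDeriv _).iterDeriv_omega0_subset (h₁.iterDeriv _) (h₂.iterDeriv _) ih F
  | limit η hη ih =>
    have e {θ : Ordinal.{0}} (hθ : θ < η) : (ω : Ordinal.{0}) ^ θ < ω ^ η :=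
      (Ordinal.opow_lt_opow_iff_right Ordinal.one_lt_omega0).2 hθ
    intro x hx
    by_contra hcon
    have hlim : Order.IsSuccLimit ((ω : Ordinal.{0}) ^ η) :=
      Ordinal.isSuccLimit_opow Ordinal.one_lt_omega0 hη
    simp only [Set.mem_union, mem_iterDeriv_limit hlim, not_or, not_forall] at hcon
    obtain ⟨⟨p, hp, hxp⟩, q, hq, hxq⟩ := hcon
    obtain ⟨θ, hθ, hpqθ⟩ := (Ordinal.lt_opow_of_isSuccLimit Ordinal.omega0_ne_zero hη).1
      (max_lt hp hq)
    rcases ih θ hθ F ((mem_iterDeriv_limit hlim).1 hx _ (e hθ)) with h' | h'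
    · exact hxp (iterDeriv_antitone h₁.subset F ((le_max_left _ _).trans hpqθ.le) h')
    · exact hxq (iterDeriv_antitone h₂.subset F ((le_max_right _ _).trans hpqθ.le) h')

/-- Below `ω₁` the default value of `derivRank` plays no role. -/
theorem derivRank_le_iff {D : Set X → Set X} (hD : ∀ F, D F ⊆ F) {θ : Ordinal.{0}} (hθ : θ < ω₁) :
    derivRank D ≤ θ ↔ iterDeriv D Set.univ θ = ∅ := by
  unfold derivRank
  constructor
  · intro h
    split_ifs at h with hex
    · have hmem : iterDeriv D Set.univ (sInf {η | iterDeriv D Set.univ η = ∅}) = ∅ := csInf_mem hex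
      exact Set.subset_eq_empty (iterDeriv_antitone hD _ h) hmem
    · exact absurd h hθ.not_ge
  · intro h
    rw [if_pos ⟨θ, h⟩]
    exact csInf_le' h

/-- In a second countable space, a local derivative that shrinks every nonempty closed set
properly exhausts the space at a countable stage: otherwise the points lost at the stages below
`ω₁` would be separated from later stages by uncountably many distinct basic open sets. -/
theorem IsLocalDeriv.exists_iterDeriv_eq_empty [TopologicalSpace X] [SecondCountableTopology X]
    {D : Set X → Set X} (hD : IsLocalDeriv D)
    (h : ∀ F : Set X, IsClosed F → F.Nonempty → ∃ x ∈ F, x ∉ D F) :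
    ∃ θ < ω₁, _root_.iterDeriv D Set.univ θ = ∅ := by
  by_contra! hcon
  have hstep : ∀ θ : Set.Iio (ω₁ : Ordinal.{0}), ∃ x, ∃ U : TopologicalSpace.countableBasis X,
      x ∈ _root_.iterDeriv D Set.univ θ.1 ∧ x ∈ U.1 ∧
        U.1 ∩ _root_.iterDeriv D Set.univ (θ.1 + 1) = ∅ := by
    intro θ
    obtain ⟨x, hx, hx'⟩ := h _ (hD.isClosed_iterDeriv θ.1) (hcon θ.1 θ.2)
    rw [← iterDeriv_add_one D] at hx'
    have hb := TopologicalSpace.isBasis_countableBasis X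
    obtain ⟨U, hU, hxU, hsub⟩ := hb.exists_subset_of_mem_open
      (Set.mem_compl hx') (hD.isClosed_iterDeriv _).isOpen_compl
    exact ⟨x, ⟨U, hU⟩, hx, hxU, Set.disjoint_iff_inter_eq_empty.1
      (Set.disjoint_left.2 fun y hy => hsub hy)⟩
  choose x U hx hxU hU using hstep
  have hne : ∀ θ η : Set.Iio (ω₁ : Ordinal.{0}), θ < η → U θ ≠ U η := by
    intro θ η hlt heq
    have hmem : x η ∈ (U θ).1 ∩ _root_.iterDeriv D Set.univ (θ.1 + 1) :=
      ⟨heq ▸ hxU η, iterDeriv_antitone hD.subset _ (Order.add_one_le_of_lt hlt) (hx η)⟩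
    rw [hU θ] at hmem
    exact hmem
  have hinj : Function.Injective U := by
    intro θ η heq
    rcases lt_trichotomy θ η with hlt | rfl | hlt
    · exact absurd heq (hne _ _ hlt)
    · rfl
    · exact absurd heq.symm (hne _ _ hlt)
  have hcount : Countable (Set.Iio (ω₁ : Ordinal.{0})) := hinj.countable
  have hcard := Cardinal.mk_le_aleph0_iff.2 hcount
  rw [Cardinal.mk_Iio_ordinal] at hcard
  simp at hcard

end LocalDerivatives

/-! ### Suprema of ranks over `ε` -/

section SupRank

variable {X : Type*}

/-- The supremum over `ε > 0` of the ranks of a family of derivatives. Both `betaRank` and `seqRank`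
are of this form by definition. -/
noncomputable def supRank (D : ℝ → Set X → Set X) : Ordinal.{0} :=
  ⨆ ε : {ε : ℝ // 0 < ε}, derivRank (D ε)

theorem supRank_le_iff {D : ℝ → Set X → Set X} (hD : ∀ ε F, D ε F ⊆ F) {θ : Ordinal.{0}}
    (hθ : θ < ω₁) : supRank D ≤ θ ↔ ∀ ε > 0, iterDeriv (D ε) Set.univ θ = ∅ := by
  simp only [supRank, Ordinal.iSup_le_iff, derivRank_le_iff (hD _) hθ, Subtype.forall, gt_iff_lt]

theorem supRank_le_of_subset {D D' : ℝ → Set X → Set X} (hD : ∀ ε F, D ε F ⊆ F)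
    (hD' : ∀ ε F, D' ε F ⊆ F) (hm : ∀ ε, Monotone (D' ε))
    (h : ∀ ε > 0, ∃ ε' > 0, ∀ F, D ε F ⊆ D' ε' F) (hω : supRank D' < ω₁) :
    supRank D ≤ supRank D' := by
  rw [supRank_le_iff hD hω]
  intro ε hε
  obtain ⟨ε', hε', hsub⟩ := h ε hε
  exact Set.subset_eq_empty (iterDeriv_subset_iterDeriv (hm ε') hsub _ _)
    ((supRank_le_iff hD' hω).1 le_rfl ε' hε')

theorem omega0_opow_lt_omega_one {η : Ordinal.{0}} (hη : η < ω₁) : (ω : Ordinal.{0}) ^ η < ω₁ := by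
  rcases eq_or_ne η 0 with rfl | h0
  · simpa using Ordinal.one_lt_omega0.trans Ordinal.omega0_lt_omega_one
  · have h1 : ω₁ = (Cardinal.aleph 1).ord := (Cardinal.ord_aleph 1).symm
    rw [h1, Cardinal.lt_ord] at hη ⊢
    rw [Ordinal.card_omega0_opow h0]
    exact max_lt Cardinal.aleph0_lt_aleph_one hη

/-- Ranks at most `ω ^ η` are preserved when, up to a change of `ε`, one family of derivatives is
dominated by the union of two others. -/
theorem supRank_le_omega0_opow [TopologicalSpace X] {D D₁ D₂ : ℝ → Set X → Set X}
    (hD : ∀ ε, IsLocalDeriv (D ε)) (h₁ : ∀ ε, IsLocalDeriv (D₁ ε)) (h₂ : ∀ ε, IsLocalDeriv (D₂ ε))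
    (h : ∀ ε > 0, ∃ ε' > 0, ∀ F, D ε F ⊆ D₁ ε' F ∪ D₂ ε' F) {η : Ordinal.{0}} (hη : η < ω₁)
    (hη₁ : supRank D₁ ≤ ω ^ η) (hη₂ : supRank D₂ ≤ ω ^ η) : supRank D ≤ ω ^ η := by
  have hω := omega0_opow_lt_omega_one hη
  rw [supRank_le_iff (fun ε => (h₁ ε).subset) hω] at hη₁
  rw [supRank_le_iff (fun ε => (h₂ ε).subset) hω] at hη₂
  rw [supRank_le_iff (fun ε => (hD ε).subset) hω]
  intro ε hε
  obtain ⟨ε', hε', hsub⟩ := h ε hε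
  have := (hD ε).iterDeriv_omega0_opow_subset (h₁ ε') (h₂ ε') hsub η Set.univ
  rwa [hη₁ ε' hε', hη₂ ε' hε', Set.union_empty, Set.subset_empty_iff] at this

theorem supRank_lt_omega_one [TopologicalSpace X] [SecondCountableTopology X]
    {D : ℝ → Set X → Set X} (hD : ∀ ε, IsLocalDeriv (D ε))
    (hanti : ∀ ε ε', ε ≤ ε' → ∀ F, D ε' F ⊆ D ε F)
    (h : ∀ ε > 0, ∀ F : Set X, IsClosed F → F.Nonempty → ∃ x ∈ F, x ∉ D ε F) :
    supRank D < ω₁ := by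
  have hpos (n : ℕ) : (0 : ℝ) < 1 / (n + 1) := by positivity
  choose θ hθ hθe using fun n : ℕ =>
    (hD (1 / (n + 1))).exists_iterDeriv_eq_empty (h _ (hpos n))
  have hsup : ⨆ n, θ n < ω₁ := Ordinal.iSup_lt_omega_one hθ
  refine lt_of_le_of_lt ((supRank_le_iff (fun ε => (hD ε).subset) hsup).2 fun ε hε => ?_) hsup
  obtain ⟨n, hn⟩ := exists_nat_one_div_lt hε
  have h1 := iterDeriv_subset_iterDeriv (hD _).mono (hanti _ _ hn.le) Set.univ (⨆ n, θ n)
  have h2 := iterDeriv_antitone (hD (1 / (n + 1))).subset Set.univ (Ordinal.le_iSup θ n)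
  exact Set.subset_eq_empty (h1.trans h2) (hθe n)

end SupRank

/-! ### Oscillation derivatives -/

section Oscillation

variable {X : Type*}

/-- The derivative attached to a set function `φ`: it keeps the points `x ∈ F` such that
`φ (U ∩ F) ≥ ε` for all open neighbourhoods `U` of `x`. -/
def localDeriv (τ : TopologicalSpace X) (φ : Set X → ℝ≥0∞) (ε : ℝ) (F : Set X) : Set X :=
  {x | x ∈ F ∧ ENNReal.ofReal ε ≤ ⨅ (U : Set X) (_ : IsOpen[τ] U) (_ : x ∈ U), φ (U ∩ F)}

/-- The diameter of the image of a set under `f`. -/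
noncomputable def oscOn (f : X → ℝ) (A : Set X) : ℝ≥0∞ :=
  ⨆ (x₁ : X) (_ : x₁ ∈ A) (x₂ : X) (_ : x₂ ∈ A), ENNReal.ofReal |f x₁ - f x₂|

/-- The defect of uniform convergence of a sequence of functions on a set, with the indices from
`N` on. -/
noncomputable def tailOscOn (fs : ℕ → X → ℝ) (N : ℕ) (A : Set X) : ℝ≥0∞ :=
  ⨆ (m : ℕ) (_ : N ≤ m) (n : ℕ) (_ : N ≤ n) (y : X) (_ : y ∈ A), ENNReal.ofReal |fs m y - fs n y|

/-- The asymptotic defect of uniform convergence of a sequence of functions on a set. -/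
noncomputable def seqOscOn (fs : ℕ → X → ℝ) (A : Set X) : ℝ≥0∞ :=
  ⨅ N : ℕ, tailOscOn fs N A

theorem oscDeriv_eq_localDeriv (τ : TopologicalSpace X) (f : X → ℝ) :
    oscDeriv τ f = localDeriv τ (oscOn f) := rfl

theorem seqOscDeriv_eq_localDeriv (τ : TopologicalSpace X) (fs : ℕ → X → ℝ) :
    seqOscDeriv τ fs = localDeriv τ (seqOscOn fs) := rfl

theorem le_oscOn {f : X → ℝ} {A : Set X} {x y : X} (hx : x ∈ A) (hy : y ∈ A) :
    ENNReal.ofReal |f x - f y| ≤ oscOn f A :=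
  le_iSup₂_of_le x hx (le_iSup₂_of_le y hy le_rfl)

theorem oscOn_le {f : X → ℝ} {A : Set X} {c : ℝ≥0∞}
    (h : ∀ x ∈ A, ∀ y ∈ A, ENNReal.ofReal |f x - f y| ≤ c) : oscOn f A ≤ c :=
  iSup₂_le fun x hx => iSup₂_le fun y hy => h x hx y hy

theorem le_tailOscOn {fs : ℕ → X → ℝ} {N m n : ℕ} {A : Set X} {y : X} (hm : N ≤ m) (hn : N ≤ n)
    (hy : y ∈ A) : ENNReal.ofReal |fs m y - fs n y| ≤ tailOscOn fs N A :=
  le_iSup₂_of_le m hm (le_iSup₂_of_le n hn (le_iSup₂_of_le y hy le_rfl))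

theorem tailOscOn_le {fs : ℕ → X → ℝ} {N : ℕ} {A : Set X} {c : ℝ≥0∞}
    (h : ∀ m ≥ N, ∀ n ≥ N, ∀ y ∈ A, ENNReal.ofReal |fs m y - fs n y| ≤ c) :
    tailOscOn fs N A ≤ c :=
  iSup₂_le fun m hm => iSup₂_le fun n hn => iSup₂_le fun y hy => h m hm n hn y hy

theorem oscOn_mono (f : X → ℝ) : Monotone (oscOn f) := fun _ _ h =>
  oscOn_le fun _ hx _ hy => le_oscOn (h hx) (h hy)

theorem tailOscOn_mono (fs : ℕ → X → ℝ) (N : ℕ) : Monotone (tailOscOn fs N) := fun _ _ h =>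
  tailOscOn_le fun _ hm _ hn _ hy => le_tailOscOn hm hn (h hy)

theorem tailOscOn_antitone_index (fs : ℕ → X → ℝ) (A : Set X) :
    Antitone fun N => tailOscOn fs N A := fun _ _ h =>
  tailOscOn_le fun _ hm _ hn _ hy => le_tailOscOn (h.trans hm) (h.trans hn) hy

theorem seqOscOn_mono (fs : ℕ → X → ℝ) : Monotone (seqOscOn fs) := fun _ _ h =>
  iInf_mono fun N => tailOscOn_mono fs N h

theorem ofReal_abs_add_le {a b : ℝ} {c d : ℝ≥0∞} (ha : ENNReal.ofReal |a| ≤ c)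
    (hb : ENNReal.ofReal |b| ≤ d) : ENNReal.ofReal |a + b| ≤ c + d :=
  calc ENNReal.ofReal |a + b| ≤ ENNReal.ofReal (|a| + |b|) :=
        ENNReal.ofReal_le_ofReal (abs_add_le a b)
    _ = ENNReal.ofReal |a| + ENNReal.ofReal |b| :=
        ENNReal.ofReal_add (abs_nonneg a) (abs_nonneg b)
    _ ≤ c + d := add_le_add ha hb

theorem oscOn_add_le (f g : X → ℝ) (A : Set X) : oscOn (f + g) A ≤ oscOn f A + oscOn g A := by
  refine oscOn_le fun x hx y hy => ?_
  have h : (f + g) x - (f + g) y = (f x - f y) + (g x - g y) := by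
    simp only [Pi.add_apply]; ring
  rw [h]
  exact ofReal_abs_add_le (le_oscOn hx hy) (le_oscOn hx hy)

theorem seqOscOn_add_le (fs gs : ℕ → X → ℝ) (A : Set X) :
    seqOscOn (fs + gs) A ≤ seqOscOn fs A + seqOscOn gs A := by
  unfold seqOscOn
  rw [ENNReal.iInf_add_iInf fun i j => ⟨max i j,
    add_le_add (tailOscOn_antitone_index fs A (le_max_left i j))
      (tailOscOn_antitone_index gs A (le_max_right i j))⟩]
  refine iInf_mono fun N => tailOscOn_le fun m hm n hn y hy => ?_
  have h : (fs + gs) m y - (fs + gs) n y = (fs m y - fs n y) + (gs m y - gs n y) := by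
    simp only [Pi.add_apply]; ring
  rw [h]
  exact ofReal_abs_add_le (le_tailOscOn hm hn hy) (le_tailOscOn hm hn hy)

theorem oscOn_smul_le (c : ℝ) (f : X → ℝ) (A : Set X) :
    oscOn (c • f) A ≤ ENNReal.ofReal |c| * oscOn f A := by
  refine oscOn_le fun x hx y hy => ?_
  have h : (c • f) x - (c • f) y = c * (f x - f y) := by
    simp only [Pi.smul_apply, smul_eq_mul]; ring
  rw [h, abs_mul, ENNReal.ofReal_mul (abs_nonneg c)]
  gcongr
  exact le_oscOn hx hy

theorem seqOscOn_smul_le {c : ℝ} (hc : c ≠ 0) (fs : ℕ → X → ℝ) (A : Set X) :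
    seqOscOn (c • fs) A ≤ ENNReal.ofReal |c| * seqOscOn fs A := by
  unfold seqOscOn
  rw [ENNReal.mul_iInf_of_ne (by simpa using hc) ENNReal.ofReal_ne_top]
  refine iInf_mono fun N => tailOscOn_le fun m hm n hn y hy => ?_
  have h : (c • fs) m y - (c • fs) n y = c * (fs m y - fs n y) := by
    simp only [Pi.smul_apply, smul_eq_mul]; ring
  rw [h, abs_mul, ENNReal.ofReal_mul (abs_nonneg c)]
  gcongr
  exact le_tailOscOn hm hn hy

theorem notMem_localDeriv_iff {τ : TopologicalSpace X} {φ : Set X → ℝ≥0∞} {ε : ℝ} {F : Set X}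
    {x : X} (hx : x ∈ F) :
    x ∉ localDeriv τ φ ε F ↔ ∃ U, IsOpen[τ] U ∧ x ∈ U ∧ φ (U ∩ F) < ENNReal.ofReal ε := by
  simp only [localDeriv, Set.mem_ofPred_eq, hx, true_and, not_le, iInf_lt_iff, exists_prop]

theorem localDeriv_subset_of_forall {τ : TopologicalSpace X} {φ : Set X → ℝ≥0∞} {ε : ℝ}
    {F S : Set X} (h : ∀ x ∈ F, x ∉ S → ∃ U, IsOpen[τ] U ∧ x ∈ U ∧ φ (U ∩ F) < ENNReal.ofReal ε) :
    localDeriv τ φ ε F ⊆ S := by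
  intro x hx
  by_contra hxS
  exact (notMem_localDeriv_iff hx.1).2 (h x hx.1 hxS) hx

theorem isLocalDeriv_localDeriv [τ : TopologicalSpace X] {φ : Set X → ℝ≥0∞} (hφ : Monotone φ)
    (ε : ℝ) : IsLocalDeriv (localDeriv τ φ ε) where
  subset F x hx := hx.1
  mono F G h := localDeriv_subset_of_forall fun x hx hxG => by
    obtain ⟨U, hU, hxU, hlt⟩ := (notMem_localDeriv_iff (h hx)).1 hxG
    exact ⟨U, hU, hxU, (hφ (Set.inter_subset_inter_right U h)).trans_lt hlt⟩
  inter_subset F V hV := by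
    rintro x ⟨hx, hxV⟩
    by_contra hxn
    obtain ⟨U, hU, hxU, hlt⟩ := (notMem_localDeriv_iff (F := F ∩ V) ⟨hx.1, hxV⟩).1 hxn
    refine (notMem_localDeriv_iff hx.1).2 ⟨U ∩ V, hU.inter hV, ⟨hxU, hxV⟩, ?_⟩ hx
    have hsub : U ∩ V ∩ F ⊆ U ∩ (F ∩ V) := fun y hy => ⟨hy.1.1, hy.2, hy.1.2⟩
    exact (hφ hsub).trans_lt hlt
  closure_inter F := by
    rintro x ⟨hx, hxF⟩
    by_contra hxn
    obtain ⟨U, hU, hxU, hlt⟩ := (notMem_localDeriv_iff hxF).1 hxn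
    obtain ⟨y, hyU, hy⟩ := mem_closure_iff.1 hx U hU hxU
    exact (notMem_localDeriv_iff hy.1).2 ⟨U, hU, hyU, hlt⟩ hy

theorem localDeriv_anti_topology {τ τ' : TopologicalSpace X} (h : τ' ≤ τ) (φ : Set X → ℝ≥0∞)
    (ε : ℝ) (F : Set X) : localDeriv τ' φ ε F ⊆ localDeriv τ φ ε F :=
  localDeriv_subset_of_forall fun x hx hxn => by
    obtain ⟨U, hU, hxU, hlt⟩ := (notMem_localDeriv_iff hx).1 hxn
    exact ⟨U, h U hU, hxU, hlt⟩

theorem localDeriv_anti_eps (τ : TopologicalSpace X) (φ : Set X → ℝ≥0∞) {ε ε' : ℝ} (h : ε ≤ ε')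
    (F : Set X) : localDeriv τ φ ε' F ⊆ localDeriv τ φ ε F :=
  fun _ hx => ⟨hx.1, (ENNReal.ofReal_le_ofReal h).trans hx.2⟩

theorem localDeriv_subset_of_le_mul (τ : TopologicalSpace X) {φ ψ : Set X → ℝ≥0∞} {c : ℝ}
    (hc : 0 < c) (h : ∀ A, φ A ≤ ENNReal.ofReal c * ψ A) (ε : ℝ) (F : Set X) :
    localDeriv τ φ ε F ⊆ localDeriv τ ψ (ε / c) F :=
  localDeriv_subset_of_forall fun x hx hxn => by
    obtain ⟨U, hU, hxU, hlt⟩ := (notMem_localDeriv_iff hx).1 hxn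
    refine ⟨U, hU, hxU, (h _).trans_lt ?_⟩
    calc ENNReal.ofReal c * ψ (U ∩ F) < ENNReal.ofReal c * ENNReal.ofReal (ε / c) :=
          (ENNReal.mul_lt_mul_iff_right (by simpa using hc) ENNReal.ofReal_ne_top).2 hlt
      _ = ENNReal.ofReal ε := by rw [← ENNReal.ofReal_mul hc.le, mul_div_cancel₀ _ hc.ne']

theorem localDeriv_subset_union (τ : TopologicalSpace X) {φ φ₁ φ₂ : Set X → ℝ≥0∞}
    (hφ₁ : Monotone φ₁) (hφ₂ : Monotone φ₂) (h : ∀ A, φ A ≤ φ₁ A + φ₂ A)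
    {ε : ℝ} (hε : 0 < ε) (F : Set X) :
    localDeriv τ φ ε F ⊆ localDeriv τ φ₁ (ε / 2) F ∪ localDeriv τ φ₂ (ε / 2) F :=
  localDeriv_subset_of_forall fun x hx hxn => by
    rw [Set.mem_union, not_or] at hxn
    obtain ⟨U, hU, hxU, hltU⟩ := (notMem_localDeriv_iff hx).1 hxn.1
    obtain ⟨V, hV, hxV, hltV⟩ := (notMem_localDeriv_iff hx).1 hxn.2
    refine ⟨U ∩ V, hU.inter hV, ⟨hxU, hxV⟩, (h _).trans_lt ?_⟩
    have e : ENNReal.ofReal ε = ENNReal.ofReal (ε / 2) + ENNReal.ofReal (ε / 2) := by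
      rw [← ENNReal.ofReal_add (by positivity) (by positivity), add_halves]
    rw [e]
    exact ENNReal.add_lt_add
      ((hφ₁ (Set.inter_subset_inter_left F Set.inter_subset_left)).trans_lt hltU)
      ((hφ₂ (Set.inter_subset_inter_left F Set.inter_subset_right)).trans_lt hltV)

/-- If a convergent sequence of continuous functions has small asymptotic oscillation at a point,
then so does its limit, because it is locally close to one of the continuous functions. -/
theorem oscDeriv_subset_seqOscDeriv {τ : TopologicalSpace X} {fs : ℕ → X → ℝ} {f : X → ℝ}
    (hc : ∀ n, Continuous[τ, inferInstance] (fs n))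
    (hlim : ∀ x, Filter.Tendsto (fun n => fs n x) Filter.atTop (𝓝 (f x))) {ε : ℝ} (hε : 0 < ε)
    (F : Set X) : oscDeriv τ f ε F ⊆ seqOscDeriv τ fs (ε / 4) F := by
  rw [oscDeriv_eq_localDeriv, seqOscDeriv_eq_localDeriv]
  refine localDeriv_subset_of_forall fun x hx hxn => ?_
  obtain ⟨U, hU, hxU, hlt⟩ := (notMem_localDeriv_iff hx).1 hxn
  obtain ⟨N, hN⟩ := iInf_lt_iff.1 hlt
  have hclose : ∀ y ∈ U ∩ F, |fs N y - f y| ≤ ε / 4 := by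
    intro y hy
    refine le_of_tendsto ((tendsto_const_nhds.sub (hlim y)).abs) ?_
    filter_upwards [Filter.eventually_ge_atTop N] with n hn
    exact (ENNReal.ofReal_le_ofReal_iff (by positivity)).1
      ((le_tailOscOn le_rfl hn hy).trans hN.le)
  refine ⟨U ∩ fs N ⁻¹' Metric.ball (fs N x) (ε / 9), hU.inter (Metric.isOpen_ball.preimage (hc N)),
    ⟨hxU, Metric.mem_ball_self (by positivity)⟩, ?_⟩
  -- `|f y - f z|` is at most `ε / 4 + 2 * (ε / 9) + ε / 4`, which is less than `3 * ε / 4`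
  refine lt_of_le_of_lt (b := ENNReal.ofReal (3 * ε / 4)) (oscOn_le fun y hy z hz => ?_)
    ((ENNReal.ofReal_lt_ofReal_iff hε).2 (by linarith))
  refine ENNReal.ofReal_le_ofReal ?_
  have hy1 := hclose y ⟨hy.1.1, hy.2⟩
  have hz1 := hclose z ⟨hz.1.1, hz.2⟩
  have hy2 : |fs N y - fs N x| < ε / 9 := hy.1.2
  have hz2 : |fs N z - fs N x| < ε / 9 := hz.1.2
  rw [abs_le] at hy1 hz1 ⊢
  rw [abs_lt] at hy2 hz2
  constructor <;> linarith [hy1.1, hy1.2, hz1.1, hz1.2, hy2.1, hy2.2, hz2.1, hz2.2]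

/-- By the Baire category theorem, a pointwise convergent sequence of continuous functions has
small asymptotic oscillation at some point of every nonempty closed set. -/
theorem exists_notMem_seqOscDeriv [τ : TopologicalSpace X] [PolishSpace X] {fs : ℕ → X → ℝ}
    {f : X → ℝ} (hc : ∀ n, Continuous (fs n))
    (hlim : ∀ x, Filter.Tendsto (fun n => fs n x) Filter.atTop (𝓝 (f x))) {ε : ℝ} (hε : 0 < ε)
    {F : Set X} (hF : IsClosed F) (hne : F.Nonempty) : ∃ x ∈ F, x ∉ seqOscDeriv τ fs ε F := by
  have : PolishSpace F := hF.polishSpace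
  have : Nonempty F := hne.to_subtype
  let C : ℕ → Set F := fun N => ⋂ (m : ℕ) (_ : N ≤ m) (n : ℕ) (_ : N ≤ n),
    {y : F | |fs m y - fs n y| ≤ ε / 2}
  have hC : ∀ N, IsClosed (C N) := fun N =>
    isClosed_iInter fun m => isClosed_iInter fun _ => isClosed_iInter fun n =>
      isClosed_iInter fun _ => isClosed_le
        (((hc m).comp continuous_subtype_val).sub ((hc n).comp continuous_subtype_val)).abs
        continuous_const
  have hU : ⋃ N, C N = Set.univ := by
    refine Set.eq_univ_of_forall fun y => Set.mem_iUnion.2 ?_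
    obtain ⟨N, hN⟩ := Metric.tendsto_atTop.1 (hlim y) (ε / 4) (by positivity)
    refine ⟨N, ?_⟩
    simp only [C, Set.mem_iInter, Set.mem_ofPred_eq]
    intro m hm n hn
    have h1 := hN m hm
    have h2 := hN n hn
    rw [Real.dist_eq, abs_lt] at h1 h2
    rw [abs_le]
    constructor <;> linarith [h1.1, h1.2, h2.1, h2.2]
  obtain ⟨N, y, hy⟩ := nonempty_interior_of_iUnion_of_closed hC hU
  obtain ⟨V, hVC, hV, hyV⟩ := mem_interior.1 hy
  obtain ⟨U, hUo, rfl⟩ := isOpen_induced_iff.1 hV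
  refine ⟨y, y.2, ?_⟩
  rw [seqOscDeriv_eq_localDeriv]
  refine (notMem_localDeriv_iff y.2).2 ⟨U, hUo, hyV, ?_⟩
  refine lt_of_le_of_lt ((iInf_le _ N).trans (tailOscOn_le fun m hm n hn z hz => ?_))
    ((ENNReal.ofReal_lt_ofReal_iff hε).2 (half_lt_self hε))
  have hzC : (⟨z, hz.2⟩ : F) ∈ C N := hVC hz.1
  simp only [C, Set.mem_iInter, Set.mem_ofPred_eq] at hzC
  exact ENNReal.ofReal_le_ofReal (hzC m hm n hn)

end Oscillation

/-! ### The ranks `β` and `γ` of functions of Baire class `1` -/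

section Ranks

variable {X : Type*}

theorem isLocalDeriv_oscDeriv [τ : TopologicalSpace X] (f : X → ℝ) (ε : ℝ) :
    IsLocalDeriv (oscDeriv τ f ε) :=
  isLocalDeriv_localDeriv (oscOn_mono f) ε

theorem isLocalDeriv_seqOscDeriv [τ : TopologicalSpace X] (fs : ℕ → X → ℝ) (ε : ℝ) :
    IsLocalDeriv (seqOscDeriv τ fs ε) :=
  isLocalDeriv_localDeriv (seqOscOn_mono fs) ε

theorem oscDeriv_subset (τ : TopologicalSpace X) (f : X → ℝ) (ε : ℝ) (F : Set X) :
    oscDeriv τ f ε F ⊆ F := fun _ hx => hx.1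

theorem seqOscDeriv_subset (τ : TopologicalSpace X) (fs : ℕ → X → ℝ) (ε : ℝ) (F : Set X) :
    seqOscDeriv τ fs ε F ⊆ F := fun _ hx => hx.1

theorem oscDeriv_mono (τ : TopologicalSpace X) (f : X → ℝ) (ε : ℝ) : Monotone (oscDeriv τ f ε) :=
  (isLocalDeriv_oscDeriv f ε).mono

theorem seqOscDeriv_mono (τ : TopologicalSpace X) (fs : ℕ → X → ℝ) (ε : ℝ) :
    Monotone (seqOscDeriv τ fs ε) :=
  (isLocalDeriv_seqOscDeriv fs ε).mono

/-- `IsLimitSeq τ fs f`: the functions `fs n` are continuous for `τ` and converge pointwise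
to `f`. -/
def IsLimitSeq (τ : TopologicalSpace X) (fs : ℕ → X → ℝ) (f : X → ℝ) : Prop :=
  (∀ n, Continuous[τ, inferInstance] (fs n)) ∧
    ∀ x, Filter.Tendsto (fun n => fs n x) Filter.atTop (𝓝 (f x))

theorem IsLimitSeq.mono {τ τ' : TopologicalSpace X} (h : τ' ≤ τ) {fs : ℕ → X → ℝ} {f : X → ℝ}
    (hf : IsLimitSeq τ fs f) : IsLimitSeq τ' fs f :=
  ⟨fun n => continuous_le_dom h (hf.1 n), hf.2⟩

theorem IsLimitSeq.add {τ : TopologicalSpace X} {fs gs : ℕ → X → ℝ} {f g : X → ℝ}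
    (hf : IsLimitSeq τ fs f) (hg : IsLimitSeq τ gs g) : IsLimitSeq τ (fs + gs) (f + g) :=
  ⟨fun n => (hf.1 n).add (hg.1 n), fun x => (hf.2 x).add (hg.2 x)⟩

theorem IsLimitSeq.const_smul {τ : TopologicalSpace X} {fs : ℕ → X → ℝ} {f : X → ℝ}
    (hf : IsLimitSeq τ fs f) (c : ℝ) : IsLimitSeq τ (c • fs) (c • f) :=
  ⟨fun n => (hf.1 n).const_smul c, fun x => (hf.2 x).const_smul c⟩

theorem IsLimitSeq.seqRank_lt {τ : TopologicalSpace X} (hτ : @PolishSpace X τ) {fs : ℕ → X → ℝ}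
    {f : X → ℝ} (hf : IsLimitSeq τ fs f) : seqRank τ fs < ω₁ :=
  supRank_lt_omega_one (isLocalDeriv_seqOscDeriv fs)
    (fun _ _ h F => localDeriv_anti_eps τ (seqOscOn fs) h F)
    fun _ hε _ hF hne => exists_notMem_seqOscDeriv hf.1 hf.2 hε hF hne

theorem IsLimitSeq.betaRank_lt {τ : TopologicalSpace X} (hτ : @PolishSpace X τ) {fs : ℕ → X → ℝ}
    {f : X → ℝ} (hf : IsLimitSeq τ fs f) : betaRank τ f < ω₁ :=
  (supRank_le_of_subset (oscDeriv_subset τ f) (seqOscDeriv_subset τ fs) (seqOscDeriv_mono τ fs)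
    (fun ε hε => ⟨ε / 4, by positivity, oscDeriv_subset_seqOscDeriv hf.1 hf.2 hε⟩)
    (hf.seqRank_lt hτ)).trans_lt (hf.seqRank_lt hτ)

theorem betaRank_anti_topology {τ τ' : TopologicalSpace X} (h : τ' ≤ τ) {f : X → ℝ}
    (hω : betaRank τ f < ω₁) : betaRank τ' f ≤ betaRank τ f :=
  supRank_le_of_subset (D := oscDeriv τ' f) (D' := oscDeriv τ f)
    (oscDeriv_subset τ' f) (oscDeriv_subset τ f) (oscDeriv_mono τ f)
    (fun ε hε => ⟨ε, hε, localDeriv_anti_topology h (oscOn f) ε⟩) hω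

theorem seqRank_anti_topology {τ τ' : TopologicalSpace X} (h : τ' ≤ τ) {fs : ℕ → X → ℝ}
    (hω : seqRank τ fs < ω₁) : seqRank τ' fs ≤ seqRank τ fs :=
  supRank_le_of_subset (D := seqOscDeriv τ' fs) (D' := seqOscDeriv τ fs)
    (seqOscDeriv_subset τ' fs) (seqOscDeriv_subset τ fs) (seqOscDeriv_mono τ fs)
    (fun ε hε => ⟨ε, hε, localDeriv_anti_topology h (seqOscOn fs) ε⟩) hω

theorem betaRank_smul_le {τ : TopologicalSpace X} {f : X → ℝ} (hω : betaRank τ f < ω₁) {c : ℝ}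
    (hc : c ≠ 0) : betaRank τ (c • f) ≤ betaRank τ f :=
  supRank_le_of_subset (oscDeriv_subset τ _) (oscDeriv_subset τ f) (oscDeriv_mono τ f)
    (fun ε hε => ⟨ε / |c|, div_pos hε (abs_pos.2 hc),
      localDeriv_subset_of_le_mul τ (abs_pos.2 hc) (oscOn_smul_le c f) ε⟩) hω

theorem seqRank_smul_le {τ : TopologicalSpace X} {fs : ℕ → X → ℝ} (hω : seqRank τ fs < ω₁) {c : ℝ}
    (hc : c ≠ 0) : seqRank τ (c • fs) ≤ seqRank τ fs :=
  supRank_le_of_subset (seqOscDeriv_subset τ _) (seqOscDeriv_subset τ fs) (seqOscDeriv_mono τ fs)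
    (fun ε hε => ⟨ε / |c|, div_pos hε (abs_pos.2 hc),
      localDeriv_subset_of_le_mul τ (abs_pos.2 hc) (seqOscOn_smul_le hc fs) ε⟩) hω

theorem betaRank_add_le {τ : TopologicalSpace X} {f g : X → ℝ} {η : Ordinal.{0}} (hη : η < ω₁)
    (hf : betaRank τ f ≤ ω ^ η) (hg : betaRank τ g ≤ ω ^ η) : betaRank τ (f + g) ≤ ω ^ η :=
  supRank_le_omega0_opow (isLocalDeriv_oscDeriv (f + g)) (isLocalDeriv_oscDeriv f)
    (isLocalDeriv_oscDeriv g) (fun ε hε => ⟨ε / 2, half_pos hε, localDeriv_subset_union τ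
      (oscOn_mono f) (oscOn_mono g) (oscOn_add_le f g) hε⟩) hη hf hg

theorem seqRank_add_le {τ : TopologicalSpace X} {fs gs : ℕ → X → ℝ} {η : Ordinal.{0}} (hη : η < ω₁)
    (hf : seqRank τ fs ≤ ω ^ η) (hg : seqRank τ gs ≤ ω ^ η) : seqRank τ (fs + gs) ≤ ω ^ η :=
  supRank_le_omega0_opow (isLocalDeriv_seqOscDeriv (fs + gs)) (isLocalDeriv_seqOscDeriv fs)
    (isLocalDeriv_seqOscDeriv gs) (fun ε hε => ⟨ε / 2, half_pos hε, localDeriv_subset_union τ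
      (seqOscOn_mono fs) (seqOscOn_mono gs) (seqOscOn_add_le fs gs) hε⟩) hη hf hg

theorem gammaRank_le_seqRank {τ : TopologicalSpace X} {fs : ℕ → X → ℝ} {f : X → ℝ}
    (hf : IsLimitSeq τ fs f) : gammaRank τ f ≤ seqRank τ fs :=
  csInf_le' ⟨fs, hf.1, hf.2, rfl⟩

theorem IsLimitSeq.exists_seqRank_eq_gammaRank {τ : TopologicalSpace X} {fs : ℕ → X → ℝ}
    {f : X → ℝ} (hf : IsLimitSeq τ fs f) :
    ∃ gs, IsLimitSeq τ gs f ∧ seqRank τ gs = gammaRank τ f := by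
  have hne : {θ : Ordinal.{0} | ∃ fs : ℕ → X → ℝ, (∀ n, Continuous[τ, inferInstance] (fs n)) ∧
    (∀ x, Filter.Tendsto (fun n => fs n x) Filter.atTop (𝓝 (f x))) ∧ seqRank τ fs = θ}.Nonempty :=
    ⟨_, fs, hf.1, hf.2, rfl⟩
  obtain ⟨gs, h1, h2, h3⟩ := csInf_mem hne
  exact ⟨gs, ⟨h1, h2⟩, h3⟩

end Ranks

/-! ### Additive Borel classes -/

section Sigma

variable {X : Type*}

theorem IsSigma0.one_le {τ : TopologicalSpace X} {ξ : Ordinal.{0}} {s : Set X}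
    (h : IsSigma0 τ ξ s) : 1 ≤ ξ := by
  cases h with
  | of_isOpen s hs => exact le_rfl
  | iUnion _ ζ A hζ hA => exact Order.one_le_iff_pos.2 (pos_of_gt (hζ 0))

theorem isSigma0_one_iff {τ : TopologicalSpace X} {s : Set X} :
    IsSigma0 τ 1 s ↔ IsOpen[τ] s := by
  refine ⟨fun h => ?_, .of_isOpen s⟩
  cases h with
  | of_isOpen s hs => exact hs
  | iUnion _ ζ A hζ hA => exact absurd (hA 0).one_le (hζ 0).not_ge

theorem isSigma0_iff_exists {τ : TopologicalSpace X} {ξ : Ordinal.{0}} (hξ : 1 < ξ) {s : Set X} :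
    IsSigma0 τ ξ s ↔ ∃ (ζ : ℕ → Ordinal.{0}) (A : ℕ → Set X), (∀ n, ζ n < ξ) ∧
      (∀ n, IsSigma0 τ (ζ n) (A n)ᶜ) ∧ ⋃ n, A n = s := by
  constructor
  · intro h
    cases h with
    | of_isOpen s hs => exact absurd hξ (lt_irrefl _)
    | iUnion _ ζ A hζ hA => exact ⟨ζ, A, hζ, hA, rfl⟩
  · rintro ⟨ζ, A, hζ, hA, rfl⟩
    exact .iUnion ξ ζ A hζ hA

theorem isSigma0_iUnion {τ : TopologicalSpace X} {ξ : Ordinal.{0}} {s : ℕ → Set X}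
    (h : ∀ n, IsSigma0 τ ξ (s n)) :
    IsSigma0 τ ξ (⋃ n, s n) := by
  rcases (h 0).one_le.eq_or_lt with rfl | hξ
  · exact .of_isOpen _ (isOpen_iUnion fun n => isSigma0_one_iff.1 (h n))
  · choose ζ A hζ hA hU using fun n => (isSigma0_iff_exists hξ).1 (h n)
    refine (isSigma0_iff_exists hξ).2 ⟨fun k => ζ k.unpair.1 k.unpair.2,
      fun k => A k.unpair.1 k.unpair.2, fun k => hζ _ _, fun k => hA _ _, ?_⟩
    rw [Set.iUnion_unpair (fun i j => A i j)]
    exact Set.iUnion_congr hU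

theorem IsSigma0.union {τ : TopologicalSpace X} {ξ : Ordinal.{0}} {s t : Set X}
    (hs : IsSigma0 τ ξ s) (ht : IsSigma0 τ ξ t) : IsSigma0 τ ξ (s ∪ t) := by
  have h : s ∪ t = ⋃ n : ℕ, if n = 0 then s else t := by
    ext x
    simp only [Set.mem_union, Set.mem_iUnion]
    constructor
    · rintro (h | h)
      · exact ⟨0, by simpa using h⟩
      · exact ⟨1, by simpa using h⟩
    · rintro ⟨n, hn⟩
      split_ifs at hn
      exacts [Or.inl hn, Or.inr hn]
  rw [h]
  exact isSigma0_iUnion fun n => by split_ifs <;> assumption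

theorem exists_countable_iUnion_of_generateFrom [t : TopologicalSpace X]
    [SecondCountableTopology X] {S : Set (Set X)} (hS : t = TopologicalSpace.generateFrom S)
    {s : Set X} (hs : IsOpen s) :
    ∃ T : Set (Set X), T.Countable ∧ (∀ u ∈ T, ∃ g : Set (Set X), g.Finite ∧ g ⊆ S ∧ ⋂₀ g = u) ∧
      ⋃₀ T = s := by
  have hb := TopologicalSpace.isTopologicalBasis_of_subbasis hS
  obtain ⟨B, hB, rfl⟩ := hb.open_eq_sUnion hs
  obtain ⟨T, hTc, hTB, hTU⟩ := TopologicalSpace.isOpen_sUnion_countable B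
    fun u hu => hb.isOpen (hB hu)
  refine ⟨T, hTc, fun u hu => ?_, hTU⟩
  obtain ⟨g, ⟨hg, hgS⟩, rfl⟩ := hB (hTB hu)
  exact ⟨g, hg, hgS, rfl⟩

variable {τ' : TopologicalSpace X} [τ : TopologicalSpace X] [PolishSpace X]

theorem isSigma0_of_isOpen {ξ : Ordinal.{0}} (hξ : 1 ≤ ξ) {s : Set X} (hs : IsOpen s) :
    IsSigma0 τ ξ s := by
  rcases hξ.eq_or_lt with rfl | hξ
  · exact .of_isOpen s hs
  · let := TopologicalSpace.upgradeIsCompletelyMetrizable X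
    obtain ⟨F, hF, -, hU, -⟩ := hs.exists_iUnion_isClosed
    exact (isSigma0_iff_exists hξ).2
      ⟨fun _ => 1, F, fun _ => hξ, fun n => .of_isOpen _ (hF n).isOpen_compl, hU⟩

theorem IsSigma0.mono {ζ ξ : Ordinal.{0}} {s : Set X} (h : IsSigma0 τ ζ s) (hle : ζ ≤ ξ) :
    IsSigma0 τ ξ s := by
  cases h with
  | of_isOpen s hs => exact isSigma0_of_isOpen hle hs
  | iUnion _ ζ' A hζ hA => exact .iUnion ξ ζ' A (fun n => (hζ n).trans_le hle) hA

theorem IsSigma0.inter {ξ : Ordinal.{0}} {s t : Set X}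
    (hs : IsSigma0 τ ξ s) (ht : IsSigma0 τ ξ t) : IsSigma0 τ ξ (s ∩ t) := by
  rcases hs.one_le.eq_or_lt with rfl | hξ
  · exact .of_isOpen _ ((isSigma0_one_iff.1 hs).inter (isSigma0_one_iff.1 ht))
  · obtain ⟨ζ, A, hζ, hA, rfl⟩ := (isSigma0_iff_exists hξ).1 hs
    obtain ⟨ζ', A', hζ', hA', rfl⟩ := (isSigma0_iff_exists hξ).1 ht
    refine (isSigma0_iff_exists hξ).2 ⟨fun k => max (ζ k.unpair.1) (ζ' k.unpair.2),
      fun k => A k.unpair.1 ∩ A' k.unpair.2, fun k => max_lt (hζ _) (hζ' _), fun k => ?_, ?_⟩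
    · rw [Set.compl_inter]
      exact ((hA _).mono (le_max_left _ _)).union ((hA' _).mono (le_max_right _ _))
    · rw [Set.iUnion_inter_iUnion, Set.iUnion_unpair (fun i j => A i ∩ A' j)]

theorem isSigma0_biUnion {ι : Type*} {T : Set ι} (hT : T.Countable) {ξ : Ordinal.{0}}
    (hξ : 1 ≤ ξ) {s : ι → Set X} (h : ∀ i ∈ T, IsSigma0 τ ξ (s i)) :
    IsSigma0 τ ξ (⋃ i ∈ T, s i) := by
  rcases T.eq_empty_or_nonempty with rfl | hne
  · simpa using isSigma0_of_isOpen hξ isOpen_empty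
  · obtain ⟨e, rfl⟩ := hT.exists_eq_range hne
    rw [Set.biUnion_range]
    exact isSigma0_iUnion fun n => h _ ⟨n, rfl⟩

/-- To check that all open sets of a second countable topology belong to an additive class, it is
enough to look at a subbasis. -/
theorem isSigma0_of_generateFrom {ξ : Ordinal.{0}} (hξ : 1 ≤ ξ)
    (hτ' : @SecondCountableTopology X τ') {S : Set (Set X)}
    (hS : τ' = TopologicalSpace.generateFrom S) (h : ∀ s ∈ S, IsSigma0 τ ξ s) {s : Set X}
    (hs : IsOpen[τ'] s) : IsSigma0 τ ξ s := by
  have hinter : ∀ g : Set (Set X), g.Finite → g ⊆ S → IsSigma0 τ ξ (⋂₀ g) := by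
    intro g hg
    induction g, hg using Set.Finite.induction_on with
    | empty => intro _; simpa using isSigma0_of_isOpen hξ isOpen_univ
    | @insert a g _ _ ih =>
      intro hsub
      rw [Set.sInter_insert]
      exact (h _ (hsub (Set.mem_insert _ _))).inter (ih ((Set.subset_insert _ _).trans hsub))
  obtain ⟨T, hTc, hT, rfl⟩ := @exists_countable_iUnion_of_generateFrom X τ' hτ' S hS s hs
  rw [Set.sUnion_eq_biUnion]
  refine isSigma0_biUnion hTc hξ fun u hu => ?_
  obtain ⟨g, hg, hgS, rfl⟩ := hT u hu
  exact hinter g hg hgS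

theorem isSigma0_of_iInf {ι : Type*} {ξ : Ordinal.{0}} (hξ : 1 ≤ ξ) {t : ι → TopologicalSpace X}
    (hc : @SecondCountableTopology X (⨅ i, t i)) (h : ∀ i s, IsOpen[t i] s → IsSigma0 τ ξ s)
    {s : Set X} (hs : IsOpen[⨅ i, t i] s) : IsSigma0 τ ξ s := by
  refine isSigma0_of_generateFrom hξ hc (S := ⋃ i, {s | IsOpen[t i] s}) ?_ ?_ hs
  · exact (generateFrom_iUnion_isOpen t).symm
  · intro s hs
    obtain ⟨i, hi⟩ := Set.mem_iUnion.1 hs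
    exact h i s hi

end Sigma

/-! ### Baire classes -/

section Baire

variable {X : Type*} {τ : TopologicalSpace X}

theorem isBaireClass_zero_iff {f : X → ℝ} :
    IsBaireClass τ 0 f ↔ Continuous[τ, inferInstance] f := by
  refine ⟨fun h => ?_, .of_continuous f⟩
  cases h with
  | of_continuous f hf => exact hf
  | of_tendsto _ ζ fs f hζ => exact absurd (hζ 0) not_lt_zero

theorem isBaireClass_iff_exists {ξ : Ordinal.{0}} (hξ : 1 ≤ ξ) {f : X → ℝ} :
    IsBaireClass τ ξ f ↔ ∃ (ζ : ℕ → Ordinal.{0}) (fs : ℕ → X → ℝ), (∀ n, ζ n < ξ) ∧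
      (∀ n, IsBaireClass τ (ζ n) (fs n)) ∧
      ∀ x, Filter.Tendsto (fun n => fs n x) Filter.atTop (𝓝 (f x)) := by
  constructor
  · intro h
    cases h with
    | of_continuous f hf => exact absurd hξ (by simp)
    | of_tendsto _ ζ fs f hζ hfs hlim => exact ⟨ζ, fs, hζ, hfs, hlim⟩
  · rintro ⟨ζ, fs, hζ, hfs, hlim⟩
    exact .of_tendsto ξ ζ fs f hζ hfs hlim

theorem isBaireClass_one_iff {f : X → ℝ} : IsBaireClass τ 1 f ↔ ∃ fs, IsLimitSeq τ fs f := by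
  rw [isBaireClass_iff_exists le_rfl]
  constructor
  · rintro ⟨ζ, fs, hζ, hfs, hlim⟩
    refine ⟨fs, fun n => ?_, hlim⟩
    have h := hfs n
    rw [Order.lt_one_iff.1 (hζ n)] at h
    exact isBaireClass_zero_iff.1 h
  · rintro ⟨fs, hfs, hlim⟩
    exact ⟨fun _ => 0, fs, fun _ => zero_lt_one, fun n => .of_continuous _ (hfs n), hlim⟩

theorem IsBaireClass.mono {ζ ξ : Ordinal.{0}} {f : X → ℝ} (h : IsBaireClass τ ζ f) (hle : ζ ≤ ξ) :
    IsBaireClass τ ξ f := by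
  rcases hle.eq_or_lt with rfl | hlt
  · exact h
  · exact .of_tendsto ξ (fun _ => ζ) (fun _ => f) f (fun _ => hlt) (fun _ => h)
      fun _ => tendsto_const_nhds

theorem IsBaireClass.const_smul {ξ : Ordinal.{0}} {f : X → ℝ} (h : IsBaireClass τ ξ f) (c : ℝ) :
    IsBaireClass τ ξ (c • f) := by
  induction h with
  | of_continuous f hf => exact .of_continuous _ (hf.const_smul c)
  | of_tendsto ξ ζ fs f hζ _ hlim ih =>
    exact .of_tendsto ξ ζ (fun n => c • fs n) _ hζ ih fun x => (hlim x).const_smul c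

theorem IsBaireClass.add {ξ : Ordinal.{0}} {f g : X → ℝ} (hf : IsBaireClass τ ξ f)
    (hg : IsBaireClass τ ξ g) : IsBaireClass τ ξ (f + g) := by
  induction ξ using WellFoundedLT.induction generalizing f g with
  | ind ξ ih =>
    rcases eq_or_ne ξ 0 with rfl | h0
    · exact .of_continuous _ ((isBaireClass_zero_iff.1 hf).add (isBaireClass_zero_iff.1 hg))
    · have h1 : 1 ≤ ξ := Order.one_le_iff_ne_zero.2 h0
      obtain ⟨ζ, fs, hζ, hfs, hflim⟩ := (isBaireClass_iff_exists h1).1 hf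
      obtain ⟨ζ', gs, hζ', hgs, hglim⟩ := (isBaireClass_iff_exists h1).1 hg
      exact .of_tendsto ξ (fun n => max (ζ n) (ζ' n)) (fun n => fs n + gs n) _
        (fun n => max_lt (hζ n) (hζ' n))
        (fun n => ih _ (max_lt (hζ n) (hζ' n)) ((hfs n).mono (le_max_left _ _))
          ((hgs n).mono (le_max_right _ _)))
        fun x => (hflim x).add (hglim x)

end Baire

/-! ### Polish refinements -/

section Refinement

/-- A `Gδ` subset `⋂ n, O n` of a Polish space is Polish: it embeds diagonally as a closed subset of
the product of the open sets `O n`. -/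
theorem IsGδ.polishSpace {Z : Type*} [TopologicalSpace Z] [PolishSpace Z] {s : Set Z}
    (hs : IsGδ s) : PolishSpace s := by
  obtain ⟨O, hO, rfl⟩ := isGδ_iff_eq_iInter_nat.1 hs
  have (n : ℕ) : PolishSpace (O n) := (hO n).polishSpace
  let e : (⋂ n, O n : Set Z) → ∀ n, O n := fun z n => ⟨z, Set.mem_iInter.1 z.2 n⟩
  have he : Continuous e := by fun_prop
  have hval : Topology.IsInducing ((fun p : ∀ n, O n => (p 0 : Z)) ∘ e) :=
    Topology.IsInducing.subtypeVal
  have hind : Topology.IsInducing e := .of_comp he (by fun_prop) hval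
  refine Topology.IsClosedEmbedding.polishSpace (f := e) ⟨⟨hind, fun a b hab => ?_⟩, ?_⟩
  · exact Subtype.ext (congrArg (fun p : ∀ n, O n => (p 0 : Z)) hab)
  · have hr : Set.range e = ⋂ n, {p : ∀ n, O n | (p n : Z) = p 0} := by
      ext p
      simp only [Set.mem_range, Set.mem_iInter, Set.mem_ofPred_eq]
      constructor
      · rintro ⟨z, rfl⟩ n
        rfl
      · intro h
        refine ⟨⟨p 0, Set.mem_iInter.2 fun n => h n ▸ (p n).2⟩, funext fun n => Subtype.ext ?_⟩
        exact (h n).symm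
    rw [hr]
    exact isClosed_iInter fun n => isClosed_eq (by fun_prop) (by fun_prop)

variable {X : Type*}

/-- The graph of a function of Baire class `1` is a `Gδ` set: `y = f x` holds as soon as `y` is a
cluster point of the convergent sequence `fs n x`. -/
theorem IsLimitSeq.isGδ_graph [τ : TopologicalSpace X] {fs : ℕ → X → ℝ} {f : X → ℝ}
    (hf : IsLimitSeq τ fs f) : IsGδ {p : X × ℝ | f p.1 = p.2} := by
  have h : {p : X × ℝ | f p.1 = p.2} =
      ⋂ (k : ℕ) (N : ℕ), ⋃ (n : ℕ) (_ : N ≤ n), {p | |fs n p.1 - p.2| < 1 / (k + 1)} := by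
    ext ⟨x, y⟩
    simp only [Set.mem_iInter, Set.mem_iUnion, Set.mem_ofPred_eq, exists_prop]
    constructor
    · rintro rfl k N
      obtain ⟨M, hM⟩ := Metric.tendsto_atTop.1 (hf.2 x) (1 / (k + 1)) (by positivity)
      exact ⟨max M N, le_max_right _ _, hM _ (le_max_left _ _)⟩
    · intro h
      refine eq_of_forall_dist_le fun ε hε => ?_
      obtain ⟨k, hk⟩ := exists_nat_one_div_lt (half_pos hε)
      obtain ⟨N, hN⟩ := Metric.tendsto_atTop.1 (hf.2 x) (ε / 2) (half_pos hε)
      obtain ⟨n, hn, hlt⟩ := h k N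
      have h1 := hN n hn
      rw [Real.dist_eq] at h1 ⊢
      rw [abs_lt] at h1 hlt
      rw [abs_le]
      constructor <;> linarith [h1.1, h1.2, hlt.1, hlt.2]
  rw [h]
  refine .iInter fun k => .iInter fun N => (isOpen_iUnion fun n => isOpen_iUnion fun _ => ?_).isGδ
  exact isOpen_lt (((hf.1 n).comp continuous_fst).sub continuous_snd).abs continuous_const

/-- Adjoining the preimages of open sets under a function of Baire class `1` to a Polish topology
gives a Polish topology, since the resulting space is homeomorphic to the graph. -/
theorem IsLimitSeq.polishSpace_inf_induced [τ : TopologicalSpace X] [PolishSpace X]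
    {fs : ℕ → X → ℝ} {f : X → ℝ} (hf : IsLimitSeq τ fs f) :
    @PolishSpace X (τ ⊓ .induced f inferInstance) := by
  have := hf.isGδ_graph.polishSpace
  let e : X ≃ {p : X × ℝ | f p.1 = p.2} :=
    { toFun := fun x => ⟨(x, f x), rfl⟩
      invFun := fun p => p.1.1
      left_inv := fun _ => rfl
      right_inv := fun p => Subtype.ext (Prod.ext rfl p.2) }
  have heq : τ ⊓ .induced f inferInstance = TopologicalSpace.induced e inferInstance := by
    change _ = TopologicalSpace.induced e (TopologicalSpace.induced Subtype.val
      (TopologicalSpace.induced Prod.fst τ ⊓ TopologicalSpace.induced Prod.snd inferInstance))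
    rw [induced_compose, induced_inf, induced_compose, induced_compose]
    exact congrArg (· ⊓ _) (induced_id (t := τ)).symm
  rw [heq]
  exact e.polishSpace_induced

/-- The preimage of an open set under a function of Baire class `1` is an `Fσ` set. -/
theorem IsLimitSeq.exists_isClosed_iUnion_eq_preimage [τ : TopologicalSpace X]
    {fs : ℕ → X → ℝ} {f : X → ℝ} (hf : IsLimitSeq τ fs f) {U : Set ℝ} (hU : IsOpen U) :
    ∃ F : ℕ → Set X, (∀ n, IsClosed (F n)) ∧ ⋃ n, F n = f ⁻¹' U := by
  -- closed sets whose interiors cover `U`; for `U = univ` the distance to `∅` is `∞`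
  let K : ℕ → Set ℝ := fun k => {y | ENNReal.ofReal (1 / (k + 1)) ≤ Metric.infEDist y Uᶜ}
  have hK (k : ℕ) : IsClosed (K k) := isClosed_le continuous_const Metric.continuous_infEDist
  have hKU (k : ℕ) : K k ⊆ U := by
    intro y hy
    by_contra hyU
    have h0 : Metric.infEDist y Uᶜ = 0 := Metric.infEDist_zero_of_mem hyU
    have h1 : (0 : ℝ≥0∞) < ENNReal.ofReal (1 / (k + 1)) := ENNReal.ofReal_pos.2 (by positivity)
    exact (h1.trans_le hy).ne' h0
  refine ⟨fun j => ⋂ (n : ℕ) (_ : j.unpair.2 ≤ n), fs n ⁻¹' K j.unpair.1, fun j =>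
    isClosed_iInter fun n => isClosed_iInter fun _ => (hK _).preimage (hf.1 n), ?_⟩
  rw [Set.iUnion_unpair (fun k N => ⋂ (n : ℕ) (_ : N ≤ n), fs n ⁻¹' K k)]
  ext x
  simp only [Set.mem_iUnion, Set.mem_iInter, Set.mem_preimage]
  constructor
  · rintro ⟨k, N, h⟩
    exact hKU k ((hK k).mem_of_tendsto (hf.2 x) (Filter.eventually_atTop.2 ⟨N, h⟩))
  · intro hx
    have hpos : 0 < Metric.infEDist (f x) Uᶜ := by
      rw [Metric.infEDist_pos_iff_notMem_closure, hU.isClosed_compl.closure_eq]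
      exact fun h => h hx
    obtain ⟨k, hk⟩ : ∃ k : ℕ, ENNReal.ofReal (1 / (k + 1)) < Metric.infEDist (f x) Uᶜ := by
      have ht : Filter.Tendsto (fun k : ℕ => ENNReal.ofReal (1 / ((k : ℝ) + 1))) Filter.atTop
          (𝓝 0) := by
        simpa using ENNReal.tendsto_ofReal tendsto_one_div_add_atTop_nhds_zero_nat
      exact (ht.eventually (gt_mem_nhds hpos)).exists
    obtain ⟨N, hN⟩ := Filter.eventually_atTop.1
      (((Metric.continuous_infEDist.tendsto _).comp (hf.2 x)).eventually (lt_mem_nhds hk))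
    exact ⟨k, N, fun n hn => (hN n hn).le⟩

/-- Countably many Polish refinements of a Polish topology with open sets in an additive Borel class
have a common refinement of the same kind. -/
theorem exists_polishSpace_le_isSigma0 [τ : TopologicalSpace X] [hτ : PolishSpace X] {ι : Type*}
    [Countable ι] {ξ : Ordinal.{0}} (hξ : 1 ≤ ξ) (t : ι → TopologicalSpace X) (hle : ∀ i, t i ≤ τ)
    (ht : ∀ i, @PolishSpace X (t i)) (h : ∀ i s, IsOpen[t i] s → IsSigma0 τ ξ s) :
    ∃ τ' : TopologicalSpace X, (∀ i, τ' ≤ t i) ∧ τ' ≤ τ ∧ @PolishSpace X τ' ∧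
      ∀ s, IsOpen[τ'] s → IsSigma0 τ ξ s := by
  have hP : @PolishSpace X (⨅ i : Option ι, i.elim τ t) :=
    .iInf ⟨none, Option.forall.2 ⟨le_rfl, hle⟩⟩ (Option.forall.2 ⟨hτ, ht⟩)
  refine ⟨⨅ i : Option ι, i.elim τ t, fun i => iInf_le _ (some i), iInf_le _ none, hP,
    fun s hs => ?_⟩
  exact isSigma0_of_iInf (τ := τ) hξ hP.toSecondCountableTopology
    (Option.forall.2 ⟨fun s hs => isSigma0_of_isOpen (τ := τ) hξ hs, h⟩) hs

/-- A function of Baire class `ζ` becomes continuous in a Polish refinement by `Σ⁰_{ζ + 1}` sets.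
One first makes the approximating functions continuous, which turns the function into one of
class `1`, and then adjoins the preimages of open sets. -/
theorem IsBaireClass.exists_continuous_refinement [τ : TopologicalSpace X] [hτ : PolishSpace X]
    {ζ : Ordinal.{0}} {f : X → ℝ} (hf : IsBaireClass τ ζ f) :
    ∃ τ' : TopologicalSpace X, τ' ≤ τ ∧ @PolishSpace X τ' ∧
      (∀ s, IsOpen[τ'] s → IsSigma0 τ (ζ + 1) s) ∧ Continuous[τ', inferInstance] f := by
  induction hf with
  | of_continuous f hf =>
    exact ⟨τ, le_rfl, hτ, fun s hs => isSigma0_of_isOpen (by simp) hs, hf⟩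
  | of_tendsto ζ ζ' fs f hζ _ hlim ih =>
    have h1 : 1 ≤ ζ := Order.one_le_iff_pos.2 (pos_of_gt (hζ 0))
    choose t htle htP htS htc using ih
    obtain ⟨σ, hσt, hσ, hσP, hσS⟩ := exists_polishSpace_le_isSigma0 h1 t htle htP
      fun n s hs => (htS n s hs).mono (Order.add_one_le_of_lt (hζ n))
    have hseq : IsLimitSeq σ fs f := ⟨fun n => continuous_le_dom (hσt n) (htc n), hlim⟩
    have hP := hseq.polishSpace_inf_induced
    refine ⟨σ ⊓ .induced f inferInstance, inf_le_left.trans hσ, hP, fun s hs => ?_,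
      continuous_le_dom inf_le_right continuous_induced_dom⟩
    have hle : ζ ≤ ζ + 1 := (Order.lt_add_one_iff.2 le_rfl).le
    let u : Bool → TopologicalSpace X := fun b => cond b σ (.induced f inferInstance)
    have hu : ⨅ b, u b = σ ⊓ .induced f inferInstance := iInf_bool_eq
    rw [← hu] at hP hs
    refine isSigma0_of_iInf (τ := τ) (t := u) (h1.trans hle) hP.toSecondCountableTopology ?_ hs
    rintro (_ | _) s hs
    · obtain ⟨U, hU, rfl⟩ := isOpen_induced_iff.1 hs
      obtain ⟨F, hF, hFU⟩ := hseq.exists_isClosed_iUnion_eq_preimage hU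
      rw [← hFU]
      exact .iUnion _ (fun _ => ζ) F (fun _ => Order.lt_add_one_iff.2 le_rfl)
        fun n => hσS _ (hF n).isOpen_compl
    · exact IsSigma0.mono (τ := τ) (hσS s hs) hle

theorem IsBaireClass.refinements_nonempty [τ : TopologicalSpace X] [PolishSpace X]
    {ξ : Ordinal.{0}} (hξ : 1 ≤ ξ) {f : X → ℝ} (hf : IsBaireClass τ ξ f) :
    (refinements τ ξ f).Nonempty := by
  obtain ⟨ζ, fs, hζ, hfs, hlim⟩ := (isBaireClass_iff_exists hξ).1 hf
  choose t htle htP htS htc using fun n => (hfs n).exists_continuous_refinement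
  obtain ⟨σ, hσt, hσ, hσP, hσS⟩ := exists_polishSpace_le_isSigma0 hξ t htle htP
    fun n s hs => (htS n s hs).mono (Order.add_one_le_of_lt (hζ n))
  exact ⟨σ, hσ, hσP, hσS,
    isBaireClass_one_iff.2 ⟨fs, fun n => continuous_le_dom (hσt n) (htc n), hlim⟩⟩

/-- Topologies admissible for `f` and for `g` have a common refinement admissible for `f + g`. -/
theorem exists_common_refinement [τ : TopologicalSpace X] [PolishSpace X] {ξ : Ordinal.{0}}
    (hξ : 1 ≤ ξ) {f g : X → ℝ} {τ₁ τ₂ : TopologicalSpace X} (h₁ : τ₁ ∈ refinements τ ξ f)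
    (h₂ : τ₂ ∈ refinements τ ξ g) :
    ∃ σ ∈ refinements τ ξ (f + g), σ ≤ τ₁ ∧ σ ≤ τ₂ := by
  obtain ⟨hle₁, hP₁, hS₁, hB₁⟩ := h₁
  obtain ⟨hle₂, hP₂, hS₂, hB₂⟩ := h₂
  obtain ⟨σ, hσt, hσ, hσP, hσS⟩ := exists_polishSpace_le_isSigma0 (τ := τ) hξ
    (fun b : Bool => cond b τ₁ τ₂) (by rintro (_ | _) <;> assumption)
    (by rintro (_ | _) <;> assumption) (by rintro (_ | _) <;> assumption)
  obtain ⟨fs, hfs⟩ := isBaireClass_one_iff.1 hB₁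
  obtain ⟨gs, hgs⟩ := isBaireClass_one_iff.1 hB₂
  exact ⟨σ, ⟨hσ, hσP, hσS, isBaireClass_one_iff.2
    ⟨_, (hfs.mono (hσt true)).add (hgs.mono (hσt false))⟩⟩, hσt true, hσt false⟩

end Refinement

/-! ### The ranks `β*` and `γ*` -/

section StarRank

variable {X : Type*} {τ : TopologicalSpace X} {ξ : Ordinal.{0}} {f : X → ℝ}

theorem starRank_le (ρ : TopologicalSpace X → (X → ℝ) → Ordinal.{0}) {τ' : TopologicalSpace X}
    (h : τ' ∈ refinements τ ξ f) : starRank ρ τ ξ f ≤ ρ τ' f :=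
  csInf_le' ⟨τ', h, rfl⟩

theorem exists_eq_starRank (ρ : TopologicalSpace X → (X → ℝ) → Ordinal.{0})
    (h : (refinements τ ξ f).Nonempty) : ∃ τ' ∈ refinements τ ξ f, ρ τ' f = starRank ρ τ ξ f := by
  obtain ⟨τ', hτ'⟩ := h
  have hne : {θ : Ordinal.{0} | ∃ τ' ∈ refinements τ ξ f, ρ τ' f = θ}.Nonempty :=
    ⟨_, τ', hτ', rfl⟩
  exact csInf_mem hne

theorem smul_mem_refinements {τ' : TopologicalSpace X} (h : τ' ∈ refinements τ ξ f) (c : ℝ) :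
    τ' ∈ refinements τ ξ (c • f) :=
  ⟨h.1, h.2.1, h.2.2.1, h.2.2.2.const_smul c⟩

theorem exists_isLimitSeq_of_mem_refinements {τ' : TopologicalSpace X}
    (h : τ' ∈ refinements τ ξ f) : ∃ fs, IsLimitSeq τ' fs f :=
  isBaireClass_one_iff.1 h.2.2.2

theorem betaStar_lt_omega_one (h : (refinements τ ξ f).Nonempty) : betaStar τ ξ f < ω₁ := by
  obtain ⟨τ', hτ'⟩ := h
  obtain ⟨fs, hfs⟩ := exists_isLimitSeq_of_mem_refinements hτ'
  exact (starRank_le betaRank hτ').trans_lt (hfs.betaRank_lt hτ'.2.1)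

theorem gammaStar_lt_omega_one (h : (refinements τ ξ f).Nonempty) : gammaStar τ ξ f < ω₁ := by
  obtain ⟨τ', hτ'⟩ := h
  obtain ⟨fs, hfs⟩ := exists_isLimitSeq_of_mem_refinements hτ'
  exact (starRank_le gammaRank hτ').trans_lt
    ((gammaRank_le_seqRank hfs).trans_lt (hfs.seqRank_lt hτ'.2.1))

/-- The minimum defining `γ*` is attained by a single sequence in a single topology. -/
theorem exists_seqRank_eq_gammaStar (h : (refinements τ ξ f).Nonempty) :
    ∃ τ' ∈ refinements τ ξ f, ∃ fs, IsLimitSeq τ' fs f ∧ seqRank τ' fs = gammaStar τ ξ f := by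
  obtain ⟨τ', hτ', heq⟩ := exists_eq_starRank gammaRank h
  obtain ⟨fs, hfs⟩ := exists_isLimitSeq_of_mem_refinements hτ'
  obtain ⟨gs, hgs, heq'⟩ := hfs.exists_seqRank_eq_gammaRank
  exact ⟨τ', hτ', gs, hgs, heq'.trans heq⟩

theorem gammaStar_le_seqRank {τ' : TopologicalSpace X} (h : τ' ∈ refinements τ ξ f)
    {fs : ℕ → X → ℝ} (hfs : IsLimitSeq τ' fs f) : gammaStar τ ξ f ≤ seqRank τ' fs :=
  (starRank_le gammaRank h).trans (gammaRank_le_seqRank hfs)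

theorem betaStar_smul_le (h : (refinements τ ξ f).Nonempty) {c : ℝ} (hc : c ≠ 0) :
    betaStar τ ξ (c • f) ≤ betaStar τ ξ f := by
  have hω := betaStar_lt_omega_one h
  obtain ⟨τ', hτ', heq⟩ := exists_eq_starRank betaRank h
  change _ = betaStar τ ξ f at heq
  rw [← heq] at hω ⊢
  exact (starRank_le betaRank (smul_mem_refinements hτ' c)).trans (betaRank_smul_le hω hc)

theorem gammaStar_smul_le (h : (refinements τ ξ f).Nonempty) {c : ℝ} (hc : c ≠ 0) :
    gammaStar τ ξ (c • f) ≤ gammaStar τ ξ f := by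
  obtain ⟨τ', hτ', fs, hfs, heq⟩ := exists_seqRank_eq_gammaStar h
  rw [← heq]
  exact (gammaStar_le_seqRank (smul_mem_refinements hτ' c) (hfs.const_smul c)).trans
    (seqRank_smul_le (hfs.seqRank_lt hτ'.2.1) hc)

theorem essLE_betaStar_add [τ : TopologicalSpace X] [PolishSpace X] (hξ : 1 ≤ ξ) {f g : X → ℝ}
    (hf : (refinements τ ξ f).Nonempty) (hg : (refinements τ ξ g).Nonempty) :
    EssLE (betaStar τ ξ (f + g)) (max (betaStar τ ξ f) (betaStar τ ξ g)) := by
  intro η _ hη hmax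
  have hfω := betaStar_lt_omega_one hf
  have hgω := betaStar_lt_omega_one hg
  obtain ⟨τ₁, h₁, e₁⟩ := exists_eq_starRank betaRank hf
  obtain ⟨τ₂, h₂, e₂⟩ := exists_eq_starRank betaRank hg
  change _ = betaStar τ ξ f at e₁
  change _ = betaStar τ ξ g at e₂
  rw [max_le_iff] at hmax
  rw [← e₁] at hfω hmax
  rw [← e₂] at hgω hmax
  obtain ⟨σ, hσ, hσ₁, hσ₂⟩ := exists_common_refinement (τ := τ) hξ h₁ h₂
  exact (starRank_le betaRank hσ).trans (betaRank_add_le hη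
    ((betaRank_anti_topology hσ₁ hfω).trans hmax.1) ((betaRank_anti_topology hσ₂ hgω).trans hmax.2))

theorem essLE_gammaStar_add [τ : TopologicalSpace X] [PolishSpace X] (hξ : 1 ≤ ξ) {f g : X → ℝ}
    (hf : (refinements τ ξ f).Nonempty) (hg : (refinements τ ξ g).Nonempty) :
    EssLE (gammaStar τ ξ (f + g)) (max (gammaStar τ ξ f) (gammaStar τ ξ g)) := by
  intro η _ hη hmax
  obtain ⟨τ₁, h₁, fs, hfs, e₁⟩ := exists_seqRank_eq_gammaStar hf
  obtain ⟨τ₂, h₂, gs, hgs, e₂⟩ := exists_seqRank_eq_gammaStar hg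
  rw [max_le_iff, ← e₁, ← e₂] at hmax
  obtain ⟨σ, hσ, hσ₁, hσ₂⟩ := exists_common_refinement (τ := τ) hξ h₁ h₂
  exact (gammaStar_le_seqRank hσ ((hfs.mono hσ₁).add (hgs.mono hσ₂))).trans (seqRank_add_le hη
    ((seqRank_anti_topology hσ₁ (hfs.seqRank_lt h₁.2.1)).trans hmax.1)
    ((seqRank_anti_topology hσ₂ (hgs.seqRank_lt h₂.2.1)).trans hmax.2))

end StarRank

theorem theoremt {X : Type*} [τ : TopologicalSpace X] [PolishSpace X]
    (ξ : Ordinal.{0}) (hξ : 1 ≤ ξ) (hξ' : ξ < ω₁) :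
    -- the minima are taken over nonempty families and the ranks take values below `ω₁`
    (∀ f : X → ℝ, IsBaireClass τ ξ f →
      (refinements τ ξ f).Nonempty ∧ betaStar τ ξ f < ω₁ ∧ gammaStar τ ξ f < ω₁) ∧
    -- the functions of Baire class `ξ` form a vector space
    (∀ f : X → ℝ, IsBaireClass τ ξ f → ∀ c : ℝ, IsBaireClass τ ξ (c • f)) ∧
    (∀ f g : X → ℝ, IsBaireClass τ ξ f → IsBaireClass τ ξ g → IsBaireClass τ ξ (f + g)) ∧
    -- homogeneity
    (∀ f : X → ℝ, IsBaireClass τ ξ f → ∀ c : ℝ, c ≠ 0 →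
      betaStar τ ξ (c • f) = betaStar τ ξ f ∧ gammaStar τ ξ (c • f) = gammaStar τ ξ f) ∧
    -- essential additivity
    (∀ f g : X → ℝ, IsBaireClass τ ξ f → IsBaireClass τ ξ g →
      EssLE (betaStar τ ξ (f + g)) (max (betaStar τ ξ f) (betaStar τ ξ g)) ∧
      EssLE (gammaStar τ ξ (f + g)) (max (gammaStar τ ξ f) (gammaStar τ ξ g))) := by
  refine ⟨fun f hf => ?_, fun f hf c => hf.const_smul c, fun f g hf hg => hf.add hg,
    fun f hf c hc => ?_, fun f g hf hg => ?_⟩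
  · have h := hf.refinements_nonempty hξ
    exact ⟨h, betaStar_lt_omega_one h, gammaStar_lt_omega_one h⟩
  · have h := hf.refinements_nonempty hξ
    have hc' := (hf.const_smul c).refinements_nonempty hξ
    have hβ := betaStar_smul_le hc' (inv_ne_zero hc)
    have hγ := gammaStar_smul_le hc' (inv_ne_zero hc)
    rw [inv_smul_smul₀ hc] at hβ hγ
    exact ⟨(betaStar_smul_le h hc).antisymm hβ, (gammaStar_smul_le h hc).antisymm hγ⟩
  · have h₁ := hf.refinements_nonempty hξ
    have h₂ := hg.refinements_nonempty hξ
    exact ⟨essLE_betaStar_add hξ h₁ h₂, essLE_gammaStar_add hξ h₁ h₂⟩
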